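/- Let $\kappa$ be an infinite regular cardinal with $\kappa^{<\kappa}=\kappa$. Write $H(\kappa^+)$ for the set of all sets whose transitive closure has size at most $\kappa$, and $ZFC^-$ for $ZFC$ without the power set axiom (with the schemas of separation and collection, and with choice in the form of the well-ordering principle). A \emph{$\kappa$-suitable model} is a transitive set $M\subseteq H(\kappa^+)$ with $\kappa\in M$ that satisfies $ZFC^-$ and is closed under sequences of length less than $\kappa$. An \emph{$M$-ultrafilter} on $\kappa$ is an ultrafilter $U$ on the Boolean algebra $P(\kappa)\cap M$. It is \emph{$\kappa$-complete} if the intersection of fewer than $\kappa$ elements of $U$ is nonempty, \emph{uniform} if all its elements have cardinality $\kappa$, and \emph{$\kappa$-amenable} if $U\cap\mathcal A\in M$ for each $\mathcal A\subseteq P(\kappa)\cap M$ such that $\mathcal A\in M$ and $|\mathcal A|^M\le\kappa$. A $\kappa$-suitable model $M$ is \emph{internally approachable} if there is a sequence $\langle N_\alpha:\alpha<\kappa^+\rangle$ of $\kappa$-suitable models with $M=\bigcup_{\alpha<\kappa^+}N_\alpha$ and $\langle N_\alpha:\alpha<\beta\rangle\in N_\beta$ for all $\beta<\kappa^+$. In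 the game $G_{\mathrm{Filter}}(\kappa,\kappa^+)$, at each stage $i<\kappa^+$ Player I plays a $\kappa$-suitable model $M_i$ of size at most $\kappa\cdot\max(1,|i|)$ (that is, at most $\kappa$) with $\bigcup_{j<i}M_j\subseteq M_i$, and then Player II plays a $\kappa$-complete uniform filter $F_i$ on $\kappa$ such that $F_i\supseteq\bigcup_{j<i}F_j$ and $F_i\cap M_i$ is a $\kappa$-complete $M_i$-ultrafilter. Player I wins if and only if at some stage $i<\kappa^+$ Player II has no legal move. A winning strategy for Player I is a strategy that always gives him legal moves and with which he wins each play. \textbf{Theorem.} Player I does not have a winning strategy in $G_{\mathrm{Filter}}(\kappa,\kappa^+)$ if and only if there are stationarily many internally approachable $\kappa$-suitable models $M\subseteq H(\kappa^+)$ such that there is a $\kappa$-amenable, $\kappa$-complete, uniform $M$-ultrafilter on $\kappa$; that is, for each function $f:[H(\kappa^+)]^{<\omega}\to H(\kappa^+)$ there is such an $M$ that is closed under $f$. -/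

import Mathlib

open Cardinal

universe u v

namespace FilterGame

noncomputable section

/-! ### The language of set theory and the theory `ZFC⁻` -/

/-- The only non-logical symbol of the language of set theory is a binary relation symbol. -/
inductive MemRel : ℕ → Type
  | mem : MemRel 2

/-- The first-order language of set theory. -/
def setLang : FirstOrder.Language.{0, 0} := ⟨fun _ => Empty, MemRel⟩

/-- A class of sets is a structure for the language of set theory, with the true membership. -/
instance memStructure (X : Set ZFSet.{u}) : setLang.Structure X where
  funMap := fun f => Empty.elim f
  RelMap := fun r v =>
    match r with
    | MemRel.mem => (v 0).1 ∈ (v 1).1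

section Axioms

variable {X : Type v} [setLang.Structure X]

/-- The interpretation of the membership symbol in a structure. -/
def E (x y : X) : Prop :=
  FirstOrder.Language.Structure.RelMap (L := setLang) (MemRel.mem : setLang.Relations 2) ![x, y]

/-- `p` is, in the sense of the structure, the Kuratowski pair `{{x}, {x, y}}`. -/
def IsPair (p x y : X) : Prop :=
  ∀ z, E z p ↔ (∀ w, E w z ↔ w = x) ∨ (∀ w, E w z ↔ w = x ∨ w = y)

/-- `⟨x, y⟩ ∈ r` in the sense of the structure. -/
def PairMem (r x y : X) : Prop := ∃ p, IsPair p x y ∧ E p r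

end Axioms

/-- The structure `X` satisfies `ZFC⁻`: `ZFC` without the power set axiom, with the schemas of
separation and collection, and with choice in the form of the well-ordering principle.
In the two schemas, `φ` is a formula in the variables `v₀, v₁, v₂, …`, the variable `v₀`
(respectively, `v₀` and `v₁`) is quantified, and the other variables are parameters. -/
structure ModelsZFCMinus (X : Type v) [setLang.Structure X] : Prop where
  extensionality : ∀ a b : X, (∀ x, E x a ↔ E x b) → a = b
  foundation : ∀ a : X, (∃ x, E x a) → ∃ x, E x a ∧ ∀ y, E y x → ¬ E y a
  pairing : ∀ a b : X, ∃ c, ∀ x, E x c ↔ x = a ∨ x = b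
  union : ∀ a : X, ∃ c, ∀ x, E x c ↔ ∃ y, E y a ∧ E x y
  infinity : ∃ c : X, (∃ e, E e c ∧ ∀ x, ¬ E x e) ∧
    ∀ x, E x c → ∃ y, E y c ∧ ∀ z, E z y ↔ E z x ∨ z = x
  separation : ∀ (φ : setLang.Formula ℕ) (p : ℕ → X) (a : X),
    ∃ c, ∀ x, E x c ↔ E x a ∧ φ.Realize (Function.update p 0 x)
  collection : ∀ (φ : setLang.Formula ℕ) (p : ℕ → X) (a : X),
    (∀ x, E x a → ∃ y, φ.Realize (Function.update (Function.update p 0 x) 1 y)) →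
    ∃ c, ∀ x, E x a →
      ∃ y, E y c ∧ φ.Realize (Function.update (Function.update p 0 x) 1 y)
  wellOrdering : ∀ a : X, ∃ r : X,
    (∀ x, E x a → ¬ PairMem r x x) ∧
    (∀ x y z, E x a → E y a → E z a → PairMem r x y → PairMem r y z → PairMem r x z) ∧
    (∀ x y, E x a → E y a → PairMem r x y ∨ x = y ∨ PairMem r y x) ∧
    ∀ b : X, (∀ x, E x b → E x a) → (∃ x, E x b) →
      ∃ m, E m b ∧ ∀ x, E x b → x = m ∨ PairMem r m x

/-! ### `H(θ)`, sequences and suitable models -/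

/-- `H(θ)`: the sets whose transitive closure has fewer than `θ` elements, that is, the sets that
are included in a transitive set with fewer than `θ` elements. -/
def H (θ : Cardinal.{u}) : Set ZFSet.{u} :=
  {x | ∃ t : ZFSet.{u}, t.IsTransitive ∧ x ⊆ t ∧ t.card < θ}

/-- The sequence `⟨f ξ : ξ < α⟩`, as a set of ordered pairs. -/
def seqSet (α : Ordinal.{u}) (f : Ordinal.{u} → ZFSet.{u}) : ZFSet.{u} :=
  ZFSet.range fun ξ : Set.Iio α => ZFSet.pair ξ.1.toZFSet (f ξ.1)

/-- The cardinal `κ` as a set: the von Neumann ordinal that is the set of all ordinals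
below `κ`. -/
def kset (κ : Cardinal.{u}) : ZFSet.{u} := κ.ord.toZFSet

/-- `κ`-suitable models: transitive sets `M ⊆ H(κ⁺)` with `κ ∈ M` that satisfy `ZFC⁻` and are
closed under sequences of length less than `κ`. -/
structure IsSuitable (κ : Cardinal.{u}) (M : ZFSet.{u}) : Prop where
  transitive : M.IsTransitive
  subset_H : (M : Set ZFSet.{u}) ⊆ H (Order.succ κ)
  card_mem : kset κ ∈ M
  models : ModelsZFCMinus (M : Set ZFSet.{u})
  closed : ∀ α < κ.ord, ∀ f : Ordinal.{u} → ZFSet.{u}, (∀ ξ < α, f ξ ∈ M) → seqSet α f ∈ M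

/-! ### `M`-ultrafilters -/

/-- `U` is an `M`-ultrafilter on `X`, that is, an ultrafilter on the Boolean algebra of the
subsets of `X` that belong to `M`. -/
structure IsMUltrafilter (M X : ZFSet.{u}) (U : Set ZFSet.{u}) : Prop where
  mem_algebra : ∀ A ∈ U, A ∈ M ∧ A ⊆ X
  whole_mem : X ∈ U
  empty_notMem : ∅ ∉ U
  inter_mem : ∀ A ∈ U, ∀ B ∈ U, A ∩ B ∈ U
  mem_of_superset : ∀ A ∈ U, ∀ B ∈ M, B ⊆ X → A ⊆ B → B ∈ U
  mem_or_compl_mem : ∀ A ∈ M, A ⊆ X → A ∈ U ∨ X \ A ∈ U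

/-- `κ`-completeness of an `M`-ultrafilter `U` on `X`: the intersection of fewer than `κ` elements
of `U` is nonempty (the intersection of no elements is `X`). -/
def IsComplete (κ : Cardinal.{u}) (X : ZFSet.{u}) (U : Set ZFSet.{u}) : Prop :=
  ∀ S : Set ZFSet.{u}, S ⊆ U → #S < lift.{u + 1} κ → ∃ x ∈ X, ∀ A ∈ S, x ∈ A

/-- Uniformity of a family of sets: all of its members have cardinality `κ`. -/
def IsUniform (κ : Cardinal.{u}) (U : Set ZFSet.{u}) : Prop := ∀ A ∈ U, A.card = κ

/-- `|A|^M ≤ κ`: the model `M` contains an injective function from `A` to `κ`. -/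
def CardLEIn (κ : Cardinal.{u}) (M A : ZFSet.{u}) : Prop :=
  ∃ f ∈ M, ZFSet.IsFunc A (kset κ) f ∧
    ∀ x y z : ZFSet.{u}, ZFSet.pair x z ∈ f → ZFSet.pair y z ∈ f → x = y

/-- An `M`-ultrafilter `U` on `X` is `κ`-amenable if `U ∩ 𝒜 ∈ M` whenever `𝒜 ∈ M` is a family of
subsets of `X` in `M` such that `|𝒜|^M ≤ κ`. -/
def IsAmenable (κ : Cardinal.{u}) (M X : ZFSet.{u}) (U : Set ZFSet.{u}) : Prop :=
  ∀ 𝒜 ∈ M, (∀ A ∈ 𝒜, A ∈ M ∧ A ⊆ X) → CardLEIn κ M 𝒜 → ZFSet.sep (· ∈ U) 𝒜 ∈ M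

/-! ### The filter games -/

/-- The trace `F ∩ M` of a filter `F` on `κ` on a set `M`. -/
def trace (κ : Cardinal.{u}) (F : Filter (kset κ)) (M : ZFSet.{u}) : Set ZFSet.{u} :=
  {A | A ∈ M ∧ A ⊆ kset κ ∧ {x : kset κ | x.1 ∈ A} ∈ F}

/-- The constraint function `Filter`: the `κ`-complete uniform filters `F` on `κ` such that
`F ∩ M` is a `κ`-complete `M`-ultrafilter. -/
def filterConstraint (κ : Cardinal.{u}) (M : ZFSet.{u}) : Set (Filter (kset κ)) :=
  {F | CardinalInterFilter F (lift.{u + 1} κ) ∧ (∀ s ∈ F, #s = lift.{u + 1} κ) ∧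
    IsMUltrafilter M (kset κ) (trace κ F M) ∧ IsComplete κ (kset κ) (trace κ F M)}

section Game

variable (κ : Cardinal.{u}) (C : ZFSet.{u} → Set (Filter (kset κ)))

/-- In a play `⟨M i, F i⟩`, the move of Player I at stage `i` obeys the rules: `M i` is a
`κ`-suitable model of size at most `κ · |i|` (at most `κ` for `i = 0`) that includes all previously
played models. -/
def LegalI (M : Ordinal.{u} → ZFSet.{u}) (i : Ordinal.{u}) : Prop :=
  IsSuitable κ (M i) ∧ (M i).card ≤ κ * max 1 i.card ∧ ∀ j < i, M j ⊆ M i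

/-- In a play `⟨M i, F i⟩`, the move of Player II at stage `i` obeys the rules: `F i ∈ C (M i)`
extends all previously played filters (in Mathlib's order on filters, `F ≤ G` means that each
member of `G` is a member of `F`). -/
def LegalII (M : Ordinal.{u} → ZFSet.{u}) (F : Ordinal.{u} → Filter (kset κ))
    (i : Ordinal.{u}) : Prop :=
  F i ∈ C (M i) ∧ ∀ j < i, F i ≤ F j

/-- A strategy for Player I gives a move at each stage `i` from the moves of both players at the
stages before `i`. -/
def StrategyI : Type (u + 1) :=
  (i : Ordinal.{u}) → (Set.Iio i → ZFSet.{u} × Filter (kset κ)) → ZFSet.{u}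

variable {κ} in
/-- At stage `i` of the play `⟨M i, F i⟩`, Player I moves according to the strategy `τ`. -/
def StrategyI.Follows (τ : StrategyI κ) (M : Ordinal.{u} → ZFSet.{u})
    (F : Ordinal.{u} → Filter (kset κ)) (i : Ordinal.{u}) : Prop :=
  M i = τ i fun j => (M j.1, F j.1)

/-- The strategy `τ` is winning for Player I in the game of length `γ` with constraint `C`: its
moves obey the rules at each position in which Player I has followed `τ` and Player II has obeyed
the rules, and no play in which Player I follows `τ` is won by Player II, that is, Player II never
manages to move according to the rules at all stages `i < γ`. (So a play in which Player I
follows `τ` reaches a stage at which Player II has no legal move.) -/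
def StrategyI.IsWinning (τ : StrategyI κ) (γ : Ordinal.{u}) : Prop :=
  (∀ (M : Ordinal.{u} → ZFSet.{u}) (F : Ordinal.{u} → Filter (kset κ)), ∀ i < γ,
    (∀ j < i, τ.Follows M F j ∧ LegalII κ C M F j) → τ.Follows M F i → LegalI κ M i) ∧
  ¬ ∃ (M : Ordinal.{u} → ZFSet.{u}) (F : Ordinal.{u} → Filter (kset κ)),
    ∀ i < γ, τ.Follows M F i ∧ LegalII κ C M F i

/-- Player I has a winning strategy in the filter game of length `γ` with constraint `C`. -/
def PlayerIHasWinningStrategy (γ : Ordinal.{u}) : Prop :=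
  ∃ τ : StrategyI κ, τ.IsWinning κ C γ

end Game

/-! ### Internally approachable models and stationarity -/

/-- The `κ`-suitable model `M` is internally approachable: it is the union of a sequence
`⟨N α : α < κ⁺⟩` of `κ`-suitable models such that `⟨N α : α < β⟩ ∈ N β` for all `β < κ⁺`. -/
def IsInternallyApproachable (κ : Cardinal.{u}) (M : ZFSet.{u}) : Prop :=
  ∃ N : Ordinal.{u} → ZFSet.{u},
    (∀ α < (Order.succ κ).ord, IsSuitable κ (N α)) ∧
    (∀ x, x ∈ M ↔ ∃ α < (Order.succ κ).ord, x ∈ N α) ∧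
    ∀ β < (Order.succ κ).ord, seqSet β N ∈ N β

/-- A family `S` of sets is stationary in the power set of `X` if for each function
`f : [X]^{<ω} → X` there is some `M ∈ S` with `M ⊆ X` that is closed under `f`. -/
def IsStationary (X : Set ZFSet.{u}) (S : Set ZFSet.{u}) : Prop :=
  ∀ f : Finset X → X, ∃ M ∈ S, (M : Set ZFSet.{u}) ⊆ X ∧
    ∀ s : Finset X, (∀ x ∈ s, x.1 ∈ M) → (f s).1 ∈ M

end

end FilterGame

namespace FilterGame

/-! ### Cardinal arithmetic -/

section Cardinals

variable {κ c : Cardinal.{u}}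

/-! From the game to models: given `f`, let Player I always play a model of size at most `κ` that is
closed under `f` and under Skolem functions for `H(κ⁺)`, and that contains the sequence of earlier
models and the traces of all earlier filters (`goodStrategy`). Such models exist because `κ^{<κ} =
κ` (`exists_closed`, `exists_isGood`), and closure under the Skolem functions gives `ZFC⁻`
(`ClosedUnder.realize_iff`, `ClosedUnder.modelsZFCMinus`). This strategy always moves legally, so if
it is not winning, Player II survives some play of length `κ⁺`. The union of the models of this play
is internally approachable, and the union of the traces is an ultrafilter on it. Regularity of `κ⁺`
puts any `κ` elements of the union into one model, so completeness is inherited. Amenability holds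
because the trace at stage `i` is an element of the model at stage `i + 1`.

From models to the game: let `τ` be a winning strategy and let `T`, the union of `N_α` for `α < κ⁺`,
carry an amenable ultrafilter `U`. Player II answers each `M_i` with the filter generated by `U ∩
M_i` (`tracePlay`). This is legal as long as `M_i ⊆ T` (`genFilter_mem_filterConstraint`), so it is
enough to show `M_i ∈ T` by induction. By regularity of `κ⁺`, all earlier models belong to a single
`N_β`, so the play up to `M_i` depends only on the fragment `W = U ∩ P(κ) ∩ N_β`
(`tracePlay_fst_congr`). By amenability `W ∈ T`. Stationarity allows `T` to be closed under the map
that sends `(W, i)` to the `i`-th model of the play computed from `W`; hence `M_i ∈ T`. Player II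
thus survives all `κ⁺` stages, a contradiction. -/

theorem small_of_mk_le_lift {ι : Type (u + 1)} (h : #ι ≤ lift.{u + 1} c) : Small.{u} ι := by
  obtain ⟨d, hd⟩ := Cardinal.mem_range_lift_of_le h
  rw [Cardinal.small_iff_lift_mk_lt_univ, ← hd]
  simpa using Cardinal.lift_lt_univ d

theorem exists_lt_ord_forall_le (hc : c.IsRegular) {ι : Type (u + 1)}
    (hι : #ι < lift.{u + 1} c) (f : ι → Ordinal.{u}) (hf : ∀ i, f i < c.ord) :
    ∃ b < c.ord, ∀ i, f i ≤ b := by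
  have := small_of_mk_le_lift hι.le
  have hι' : #(Shrink.{u} ι) < c := by
    rw [← Cardinal.lift_lt.{u, u + 1}, Cardinal.lift_mk_shrink'']
    exact hι
  refine ⟨⨆ i : Shrink.{u} ι, f ((equivShrink ι).symm i),
    Ordinal.iSup_lt_of_lt_cof (by rwa [hc.cof_ord]) fun i => hf _, fun i => ?_⟩
  simpa using Ordinal.le_iSup (fun i : Shrink.{u} ι => f ((equivShrink ι).symm i))
    (equivShrink ι i)

theorem mk_Iio_lt_lift {α : Ordinal.{u}} (h : α < c.ord) : #(Set.Iio α) < lift.{u + 1} c := by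
  rw [Cardinal.mk_Iio_ordinal, Cardinal.lift_lt]
  exact Cardinal.lt_ord.1 h

theorem card_le_of_lt_succ_ord {α : Ordinal.{u}} (h : α < (Order.succ κ).ord) : α.card ≤ κ :=
  Order.lt_succ_iff.1 (Cardinal.lt_ord.1 h)

theorem succ_lt_ord (hc : ℵ₀ ≤ c) {α : Ordinal.{u}} (h : α < c.ord) : α + 1 < c.ord :=
  (Cardinal.isSuccLimit_ord hc).succ_lt h

end Cardinals

theorem card_le_iff {x : ZFSet.{u}} {κ : Cardinal.{u}} :
    x.card ≤ κ ↔ #(x : Set ZFSet.{u}) ≤ lift.{u + 1} κ := by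
  rw [← Cardinal.lift_le.{u + 1}, ← ZFSet.cardinalMk_coe_sort]
  rfl

theorem card_range_le {ι : Type (u + 1)} [Small.{u} ι] {f : ι → ZFSet.{u}} {κ : Cardinal.{u}}
    (h : #ι ≤ lift.{u + 1} κ) : (ZFSet.range f).card ≤ κ := by
  rw [card_le_iff, ZFSet.coe_range]
  exact Cardinal.mk_range_le.trans h

theorem mem_sep' {p : ZFSet.{u} → Prop} {x y : ZFSet.{u}} :
    y ∈ ZFSet.sep p x ↔ y ∈ x ∧ p y := ZFSet.mem_sep

/-! ### The class `H(κ⁺)` -/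

section H

variable {κ : Cardinal.{u}}

theorem mem_H_iff {x : ZFSet.{u}} : x ∈ H (Order.succ κ) ↔
    ∃ t : ZFSet.{u}, t.IsTransitive ∧ x ⊆ t ∧ t.card ≤ κ := by
  simp [H, Order.lt_succ_iff]

theorem card_le_of_mem_H {x : ZFSet.{u}} (h : x ∈ H (Order.succ κ)) : x.card ≤ κ := by
  obtain ⟨t, -, hx, ht⟩ := mem_H_iff.1 h
  exact (ZFSet.card_mono hx).trans ht

theorem mem_H_of_mem {x y : ZFSet.{u}} (h : x ∈ H (Order.succ κ)) (hy : y ∈ x) :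
    y ∈ H (Order.succ κ) := by
  obtain ⟨t, ht, hx, hc⟩ := mem_H_iff.1 h
  exact mem_H_iff.2 ⟨t, ht, ht _ (hx hy), hc⟩

theorem mem_H_of_subset {x y : ZFSet.{u}} (h : x ∈ H (Order.succ κ)) (hy : y ⊆ x) :
    y ∈ H (Order.succ κ) := by
  obtain ⟨t, ht, hx, hc⟩ := mem_H_iff.1 h
  exact mem_H_iff.2 ⟨t, ht, fun _ hz => hx (hy hz), hc⟩

/-- The union of `x` with transitive sets of size at most `κ` around its elements is transitive, and
it has size at most `κ + κ · κ = κ`. -/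
theorem mem_H_of_forall_mem (hκ : ℵ₀ ≤ κ) {x : ZFSet.{u}} (hc : x.card ≤ κ)
    (h : ∀ y ∈ x, y ∈ H (Order.succ κ)) : x ∈ H (Order.succ κ) := by
  choose! t ht hyt htc using fun y hy => mem_H_iff.1 (h y hy)
  refine mem_H_iff.2 ⟨x ∪ ZFSet.iUnion fun y : Shrink.{u} x => t ((equivShrink x).symm y),
    ?_, fun z hz => ZFSet.mem_union.2 (.inl hz), ?_⟩
  · intro y hy z hz
    simp only [ZFSet.mem_union, ZFSet.mem_iUnion] at hy ⊢
    right
    rcases hy with hy | ⟨i, hi⟩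
    · exact ⟨equivShrink x ⟨y, hy⟩, by simpa using hyt y hy hz⟩
    · exact ⟨i, ht _ ((equivShrink x).symm i).2 _ hi hz⟩
  · refine ZFSet.card_union_le.trans ((add_le_add hc ?_).trans (Cardinal.add_eq_self hκ).le)
    have := ZFSet.lift_card_iUnion_le_sum_card.{u, u}
      (f := fun y : Shrink.{u} x => t ((equivShrink x).symm y))
    rw [Cardinal.lift_id] at this
    refine this.trans ((Cardinal.sum_le_sum _ (fun _ => κ) fun i =>
      htc _ ((equivShrink x).symm i).2).trans ?_)
    rw [Cardinal.sum_const']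
    exact (mul_le_mul_left hc κ).trans (Cardinal.mul_eq_self hκ).le

theorem range_mem_H (hκ : ℵ₀ ≤ κ) {ι : Type (u + 1)} [Small.{u} ι] {f : ι → ZFSet.{u}}
    (h : #ι ≤ lift.{u + 1} κ) (hf : ∀ i, f i ∈ H (Order.succ κ)) :
    ZFSet.range f ∈ H (Order.succ κ) := by
  refine mem_H_of_forall_mem hκ (card_range_le h) fun y hy => ?_
  obtain ⟨i, rfl⟩ := ZFSet.mem_range.1 hy
  exact hf i

theorem empty_mem_H : (∅ : ZFSet.{u}) ∈ H (Order.succ κ) :=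
  mem_H_iff.2 ⟨∅, ZFSet.isTransitive_empty, fun _ h => h, by simp⟩

theorem upair_mem_H (hκ : ℵ₀ ≤ κ) {x y : ZFSet.{u}} (hx : x ∈ H (Order.succ κ))
    (hy : y ∈ H (Order.succ κ)) : ({x, y} : ZFSet.{u}) ∈ H (Order.succ κ) := by
  refine mem_H_of_forall_mem hκ ?_ fun z hz => ?_
  · refine (ZFSet.card_insert_le.trans ?_).trans hκ
    rw [ZFSet.card_singleton, one_add_one_eq_two]
    exact Cardinal.ofNat_lt_aleph0.le
  · rcases ZFSet.mem_pair.1 hz with rfl | rfl <;> assumption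

theorem pair_mem_H (hκ : ℵ₀ ≤ κ) {x y : ZFSet.{u}} (hx : x ∈ H (Order.succ κ))
    (hy : y ∈ H (Order.succ κ)) : ZFSet.pair x y ∈ H (Order.succ κ) := by
  refine upair_mem_H hκ ?_ (upair_mem_H hκ hx hy)
  rw [← ZFSet.pair_eq_singleton]
  exact upair_mem_H hκ hx hx

theorem sUnion_mem_H {x : ZFSet.{u}} (hx : x ∈ H (Order.succ κ)) :
    (ZFSet.sUnion x) ∈ H (Order.succ κ) := by
  obtain ⟨t, ht, hx, hc⟩ := mem_H_iff.1 hx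
  refine mem_H_iff.2 ⟨t, ht, fun z hz => ?_, hc⟩
  obtain ⟨y, hy, hz⟩ := ZFSet.mem_sUnion.1 hz
  exact ht _ (hx hy) hz

theorem toZFSet_mem_H {α : Ordinal.{u}} (hα : α < (Order.succ κ).ord) :
    α.toZFSet ∈ H (Order.succ κ) :=
  mem_H_iff.2 ⟨α.toZFSet, (ZFSet.isOrdinal_toZFSet α).isTransitive, fun _ h => h, by
    rw [Ordinal.card_toZFSet]; exact card_le_of_lt_succ_ord hα⟩

theorem ord_lt_succ_ord : κ.ord < (Order.succ κ).ord :=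
  Cardinal.ord_lt_ord.2 (Order.lt_succ κ)

theorem kset_mem_H : kset κ ∈ H (Order.succ κ) := toZFSet_mem_H ord_lt_succ_ord

theorem seqSet_mem_H (hκ : ℵ₀ ≤ κ) {α : Ordinal.{u}} (hα : α < (Order.succ κ).ord)
    {f : Ordinal.{u} → ZFSet.{u}} (hf : ∀ ξ < α, f ξ ∈ H (Order.succ κ)) :
    seqSet α f ∈ H (Order.succ κ) := by
  refine range_mem_H hκ ?_ fun ξ => pair_mem_H hκ (toZFSet_mem_H (ξ.2.trans hα)) (hf _ ξ.2)
  rw [Cardinal.mk_Iio_ordinal, Cardinal.lift_le]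
  exact card_le_of_lt_succ_ord hα

theorem mem_H_of_isTransitive {M : ZFSet.{u}} (hM : M.IsTransitive) (hc : M.card ≤ κ) :
    M ∈ H (Order.succ κ) :=
  mem_H_iff.2 ⟨M, hM, fun _ h => h, hc⟩

end H

/-! ### Sequences and ordered pairs as sets -/

theorem mem_seqSet {α : Ordinal.{u}} {f : Ordinal.{u} → ZFSet.{u}} {x : ZFSet.{u}} :
    x ∈ seqSet α f ↔ ∃ ξ < α, ZFSet.pair ξ.toZFSet (f ξ) = x := by
  simp [seqSet]

theorem mem_of_pair_mem {M x y : ZFSet.{u}} (hM : M.IsTransitive) (h : ZFSet.pair x y ∈ M) :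
    x ∈ M ∧ y ∈ M := by
  have h2 : ({x, y} : ZFSet.{u}) ∈ M := hM _ h (by simp [ZFSet.pair])
  exact ⟨hM _ h2 (by simp), hM _ h2 (by simp)⟩

/-! ### Closing a set under operations on sequences of length less than `κ` -/

section Closure

variable {κ : Cardinal.{u}} {A : Type (u + 1)}
  (D : List A → Set A) (q : (α : Ordinal.{u}) → (Set.Iio α → A) → A)

/-- One step of the closure of a set under the operations `D` on finite sequences and `q` on
sequences of length less than `κ`. -/
def closureStep (κ : Cardinal.{u}) (S : Set A) : Set A :=
  S ∪ ((⋃ l : List S, D (l.map Subtype.val)) ∪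
    Set.range fun p : Σ α : Set.Iio κ.ord, (Set.Iio α.1 → S) => q p.1.1 fun i => (p.2 i).1)

/-- The stages of the closure of `X`. -/
def closureStage (κ : Cardinal.{u}) (X : Set A) (ξ : Ordinal.{u}) : Set A :=
  closureStep D q κ (X ∪ ⋃ η : Set.Iio ξ, closureStage κ X η.1)
termination_by ξ
decreasing_by exact η.2

/-- There are `κ` lengths, and at most `κ^{<κ} = κ` sequences of each length. This is where the
arithmetic hypothesis enters. -/
theorem mk_sequences_le (hreg : κ.IsRegular) (hpow : κ ^< κ = κ) {S : Set A}
    (hS : #S ≤ lift.{u + 1} κ) :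
    #(Σ α : Set.Iio κ.ord, (Set.Iio α.1 → S)) ≤ lift.{u + 1} κ := by
  rw [Cardinal.mk_sigma]
  refine (Cardinal.sum_le_sum _ (fun _ => lift.{u + 1} κ) fun α => ?_).trans ?_
  · rw [← Cardinal.power_def, Cardinal.mk_Iio_ordinal]
    refine (Cardinal.power_le_power_right hS).trans ?_
    rw [← Cardinal.lift_power, Cardinal.lift_le]
    exact (Cardinal.le_powerlt κ (Cardinal.lt_ord.1 α.2)).trans hpow.le
  · rw [Cardinal.sum_const', Cardinal.mk_Iio_ordinal, Cardinal.card_ord]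
    exact (Cardinal.mul_eq_self (by simpa using hreg.aleph0_le)).le

theorem mk_closureStep_le (hreg : κ.IsRegular) (hpow : κ ^< κ = κ)
    (hD : ∀ l, #(D l) ≤ lift.{u + 1} κ) {S : Set A} (hS : #S ≤ lift.{u + 1} κ) :
    #(closureStep D q κ S) ≤ lift.{u + 1} κ := by
  have hκ : ℵ₀ ≤ lift.{u + 1} κ := by simpa using hreg.aleph0_le
  refine (Cardinal.mk_union_le _ _).trans (Cardinal.add_le_of_le hκ hS ?_)
  refine (Cardinal.mk_union_le _ _).trans (Cardinal.add_le_of_le hκ ?_ ?_)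
  · refine (Cardinal.mk_iUnion_le_sum_mk.trans
      (Cardinal.sum_le_sum _ (fun _ => lift.{u + 1} κ) fun l => hD _)).trans ?_
    rw [Cardinal.sum_const']
    exact (mul_le_mul_left ((Cardinal.mk_list_le_max _).trans (max_le hκ hS)) _).trans
      (Cardinal.mul_eq_self hκ).le
  · exact Cardinal.mk_range_le.trans (mk_sequences_le hreg hpow hS)

theorem mk_iUnion_Iio_le (hκ : ℵ₀ ≤ κ) {ξ : Ordinal.{u}} (hξ : ξ ≤ κ.ord)
    {S : Ordinal.{u} → Set A} (hS : ∀ η < ξ, #(S η) ≤ lift.{u + 1} κ) :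
    #(⋃ η : Set.Iio ξ, S η.1 : Set A) ≤ lift.{u + 1} κ := by
  have hκ' : ℵ₀ ≤ lift.{u + 1} κ := by simpa using hκ
  refine (Cardinal.mk_iUnion_le_sum_mk.trans
    (Cardinal.sum_le_sum _ (fun _ => lift.{u + 1} κ) fun η => hS _ η.2)).trans ?_
  rw [Cardinal.sum_const', Cardinal.mk_Iio_ordinal]
  refine (mul_le_mul_left (Cardinal.lift_le.2 ?_) _).trans (Cardinal.mul_eq_self hκ').le
  simpa using Ordinal.card_le_card hξ

theorem mk_closureStage_le (hreg : κ.IsRegular) (hpow : κ ^< κ = κ)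
    (hD : ∀ l, #(D l) ≤ lift.{u + 1} κ) {X : Set A} (hX : #X ≤ lift.{u + 1} κ)
    (ξ : Ordinal.{u}) (hξ : ξ < κ.ord) :
    #(closureStage D q κ X ξ) ≤ lift.{u + 1} κ := by
  induction ξ using WellFoundedLT.induction with
  | ind ξ ih =>
    rw [closureStage]
    refine mk_closureStep_le D q hreg hpow hD ?_
    exact (Cardinal.mk_union_le _ _).trans (Cardinal.add_le_of_le
      (by simpa using hreg.aleph0_le) hX
      (mk_iUnion_Iio_le hreg.aleph0_le hξ.le fun η hη => ih η hη (hη.trans hξ)))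

/-- The closing-off is iterated `κ` times. As `κ` is regular, fewer than `κ` elements of the union
already appear by some stage `ξ < κ`, and the operations applied to them have their values in stage
`ξ + 1`. -/
theorem exists_closed (hreg : κ.IsRegular) (hpow : κ ^< κ = κ)
    (hD : ∀ l, #(D l) ≤ lift.{u + 1} κ) {X : Set A} (hX : #X ≤ lift.{u + 1} κ) :
    ∃ Y : Set A, X ⊆ Y ∧ #Y ≤ lift.{u + 1} κ ∧ (∀ l : List A, (∀ x ∈ l, x ∈ Y) → D l ⊆ Y) ∧
      ∀ α < κ.ord, ∀ f : Set.Iio α → A, (∀ i, f i ∈ Y) → q α f ∈ Y := by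
  have hsub : ∀ {ξ η : Ordinal.{u}}, ξ < η →
      closureStage D q κ X ξ ⊆ X ∪ ⋃ η' : Set.Iio η, closureStage D q κ X η'.1 :=
    fun {ξ η} h => (Set.subset_iUnion
      (fun η' : Set.Iio η => closureStage D q κ X η'.1) ⟨ξ, h⟩).trans Set.subset_union_right
  have hmono : ∀ {ξ η : Ordinal.{u}}, ξ ≤ η →
      closureStage D q κ X ξ ⊆ closureStage D q κ X η := by
    intro ξ η h
    rcases h.eq_or_lt with rfl | h
    · exact subset_rfl
    · rw [closureStage.eq_1 D q κ X η]
      exact (hsub h).trans Set.subset_union_left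
  have hpos : 0 < κ.ord := hreg.ord_pos
  refine ⟨⋃ ξ : Set.Iio κ.ord, closureStage D q κ X ξ.1, ?_, ?_, ?_, ?_⟩
  · refine subset_trans ?_ (Set.subset_iUnion _ (⟨0, hpos⟩ : Set.Iio κ.ord))
    rw [closureStage]
    exact Set.subset_union_left.trans Set.subset_union_left
  · exact mk_iUnion_Iio_le hreg.aleph0_le le_rfl
      fun ξ hξ => mk_closureStage_le D q hreg hpow hD hX ξ hξ
  · intro l hl y hy
    have : ∃ ξ < κ.ord, ∀ x ∈ l, x ∈ closureStage D q κ X ξ := by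
      clear hy
      induction l with
      | nil => exact ⟨0, hpos, by simp⟩
      | cons a l ih =>
        obtain ⟨ξ, hξ, h⟩ := ih fun x hx => hl x (List.mem_cons_of_mem _ hx)
        obtain ⟨⟨η, hη⟩, ha⟩ := Set.mem_iUnion.1 (hl a List.mem_cons_self)
        refine ⟨max ξ η, max_lt hξ hη, fun x hx => ?_⟩
        rcases List.mem_cons.1 hx with rfl | hx
        · exact hmono (le_max_right _ _) ha
        · exact hmono (le_max_left _ _) (h x hx)
    obtain ⟨ξ, hξ, h⟩ := this
    refine Set.mem_iUnion.2 ⟨⟨ξ + 1, succ_lt_ord hreg.aleph0_le hξ⟩, ?_⟩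
    rw [closureStage]
    right; left
    refine Set.mem_iUnion.2 ⟨l.attach.map fun x => ⟨x.1, hsub (lt_add_one ξ) (h x.1 x.2)⟩, ?_⟩
    simpa using hy
  · intro α hα f hf
    choose g hg using fun i => Set.mem_iUnion.1 (hf i)
    obtain ⟨ξ, hξ, h⟩ := exists_lt_ord_forall_le hreg (mk_Iio_lt_lift hα)
      (fun i => (g i).1) fun i => (g i).2
    refine Set.mem_iUnion.2 ⟨⟨ξ + 1, succ_lt_ord hreg.aleph0_le hξ⟩, ?_⟩
    rw [closureStage]
    right; right
    exact ⟨⟨⟨α, hα⟩, fun i => ⟨f i, hsub (lt_add_one ξ) (hmono (h i) (hg i))⟩⟩, rfl⟩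

end Closure

/-- A set of size at most `κ` is included in one of size at most `κ` that is closed under given
operations with values of size at most `κ` and under sequences of length less than `κ`. -/
theorem exists_closed_zfset {κ : Cardinal.{u}} (hreg : κ.IsRegular) (hpow : κ ^< κ = κ)
    (D : List (H (Order.succ κ)) → Set (H (Order.succ κ)))
    (hD : ∀ l, #(D l) ≤ lift.{u + 1} κ) (X : ZFSet.{u}) (hXc : X.card ≤ κ)
    (hX : (X : Set ZFSet.{u}) ⊆ H (Order.succ κ)) :
    ∃ N : ZFSet.{u}, X ⊆ N ∧ N.card ≤ κ ∧ (N : Set ZFSet.{u}) ⊆ H (Order.succ κ) ∧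
      (∀ l : List (H (Order.succ κ)), (∀ x ∈ l, x.1 ∈ N) → ∀ y ∈ D l, y.1 ∈ N) ∧
      ∀ α < κ.ord, ∀ f : Ordinal.{u} → ZFSet.{u}, (∀ ξ < α, f ξ ∈ N) → seqSet α f ∈ N := by
  classical
  let q : (α : Ordinal.{u}) → (Set.Iio α → H (Order.succ κ)) → H (Order.succ κ) := fun α f =>
    if hα : α < κ.ord then
      ⟨ZFSet.range fun ξ : Set.Iio α => ZFSet.pair ξ.1.toZFSet (f ξ),
        range_mem_H hreg.aleph0_le (mk_Iio_lt_lift hα).le fun ξ => pair_mem_H hreg.aleph0_le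
          (toZFSet_mem_H (ξ.2.trans (hα.trans ord_lt_succ_ord))) (f ξ).2⟩
    -- A dummy value: only lengths below `κ` occur in the closure.
    else ⟨∅, empty_mem_H⟩
  obtain ⟨Y, hXY, hYc, hYD, hYq⟩ := exists_closed (κ := κ) D q hreg hpow hD
    (X := {x : H (Order.succ κ) | x.1 ∈ X}) (by
      refine le_trans ?_ (card_le_iff.1 hXc)
      exact Cardinal.mk_le_of_injective (f := fun x => (⟨x.1.1, x.2⟩ : (X : Set ZFSet.{u})))
        fun x y h => Subtype.ext (Subtype.ext (Subtype.mk.inj h)))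
  have : Small.{u} Y := small_of_mk_le_lift hYc
  have hmem : ∀ x : H (Order.succ κ), x.1 ∈ ZFSet.range (fun y : Y => y.1.1) ↔ x ∈ Y := by
    simp
  refine ⟨ZFSet.range fun y : Y => y.1.1, fun x hx => (hmem ⟨x, hX hx⟩).2 (hXY hx),
    card_range_le hYc, ?_, ?_, ?_⟩
  · intro x hx
    obtain ⟨y, rfl⟩ := ZFSet.mem_range.1 hx
    exact y.1.2
  · intro l hl y hy
    exact (hmem y).2 (hYD l (fun x hx => (hmem x).1 (hl x hx)) hy)
  · intro α hα f hf
    have hfH : ∀ ξ < α, f ξ ∈ H (Order.succ κ) := by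
      intro ξ hξ
      obtain ⟨y, hy⟩ := ZFSet.mem_range.1 (hf ξ hξ)
      exact hy ▸ y.1.2
    have := hYq α hα (fun ξ => ⟨f ξ.1, hfH ξ.1 ξ.2⟩) fun ξ => (hmem _).1 (hf ξ.1 ξ.2)
    rw [← hmem] at this
    simpa only [q, dif_pos hα, seqSet] using this

open FirstOrder FirstOrder.Language

/-! ### Formulas of the language of set theory -/

section Formulas

instance : IsEmpty (Σ n, setLang.Functions n) := ⟨fun x => Empty.elim x.2⟩

instance : Countable (Σ n, setLang.Relations n) := by
  refine Function.Injective.countable (f := fun x : Σ n, MemRel n => x.1) ?_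
  rintro ⟨_, ⟨⟩⟩ ⟨_, ⟨⟩⟩ _
  rfl

instance : Countable (Σ n, setLang.BoundedFormula ℕ n) := by
  rw [← Cardinal.mk_le_aleph0_iff]
  refine BoundedFormula.card_le.trans (max_le le_rfl ?_)
  have h1 : #(Σ n, setLang.Functions n) = 0 := Cardinal.mk_eq_zero _
  have h2 : #(Σ n, setLang.Relations n) ≤ ℵ₀ := Cardinal.mk_le_aleph0
  have : setLang.card ≤ ℵ₀ := by
    rw [Language.card_eq_card_functions_add_card_relations]
    simp only [Cardinal.lift_id]
    rw [Cardinal.mk_sigma] at h1 h2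
    rw [h1, zero_add]
    exact h2
  simpa using this

instance : Countable (setLang.Formula ℕ) :=
  Function.Injective.countable (f := fun φ => (⟨0, φ⟩ : Σ n, setLang.BoundedFormula ℕ n))
    fun _ _ h => by simpa using h

instance : Countable (Σ n, setLang.BoundedFormula ℕ (n + 1)) :=
  Function.Injective.countable
    (f := fun φ => (⟨φ.1 + 1, φ.2⟩ : Σ n, setLang.BoundedFormula ℕ n)) (by
      rintro ⟨n, φ⟩ ⟨m, ψ⟩ h
      obtain rfl : n = m := by simpa using congrArg Sigma.fst h
      simpa using h)

theorem exists_bound_term_realize {n : ℕ} (t : setLang.Term (ℕ ⊕ Fin n)) :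
    ∃ N, ∀ {X : Type v} [setLang.Structure X] (p q : ℕ → X) (v : Fin n → X),
      (∀ k < N, p k = q k) → t.realize (Sum.elim p v) = t.realize (Sum.elim q v) := by
  cases t with
  | var i =>
    cases i with
    | inl k => exact ⟨k + 1, fun p q v h => h k k.lt_succ_self⟩
    | inr k => exact ⟨0, fun p q v h => rfl⟩
  | func f ts => exact Empty.elim f

/-- The truth of a formula depends on finitely many parameters only. -/
theorem exists_bound_realize {n : ℕ} (φ : setLang.BoundedFormula ℕ n) :
    ∃ N, ∀ {X : Type v} [setLang.Structure X] (p q : ℕ → X) (v : Fin n → X),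
      (∀ k < N, p k = q k) → (φ.Realize p v ↔ φ.Realize q v) := by
  induction φ with
  | falsum => exact ⟨0, fun p q v h => Iff.rfl⟩
  | equal t₁ t₂ =>
    obtain ⟨N₁, h₁⟩ := exists_bound_term_realize.{v} t₁
    obtain ⟨N₂, h₂⟩ := exists_bound_term_realize.{v} t₂
    refine ⟨max N₁ N₂, fun p q v h => ?_⟩
    simp only [BoundedFormula.Realize]
    rw [h₁ p q v fun k hk => h k (lt_max_of_lt_left hk),
      h₂ p q v fun k hk => h k (lt_max_of_lt_right hk)]
  | rel R ts =>
    choose N hN using fun i => exists_bound_term_realize.{v} (ts i)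
    refine ⟨Finset.univ.sup N, fun p q v h => ?_⟩
    simp only [BoundedFormula.Realize]
    have : (fun i => (ts i).realize (Sum.elim p v)) = fun i => (ts i).realize (Sum.elim q v) :=
      funext fun i => hN i p q v fun k hk =>
        h k (hk.trans_le (Finset.le_sup (f := N) (Finset.mem_univ i)))
    rw [this]
  | imp φ ψ h₁ h₂ =>
    obtain ⟨N₁, h₁⟩ := h₁
    obtain ⟨N₂, h₂⟩ := h₂
    refine ⟨max N₁ N₂, fun p q v h => ?_⟩
    simp only [BoundedFormula.Realize]
    rw [h₁ p q v fun k hk => h k (lt_max_of_lt_left hk),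
      h₂ p q v fun k hk => h k (lt_max_of_lt_right hk)]
  | all φ h =>
    obtain ⟨N, hN⟩ := h
    refine ⟨N, fun p q v h => ?_⟩
    simp only [BoundedFormula.Realize]
    exact forall_congr' fun a => hN p q _ h

end Formulas

theorem E_iff {X : Set ZFSet.{u}} {x y : X} : E x y ↔ x.1 ∈ y.1 := Iff.rfl

/-! ### Operations on `H(κ⁺)` that generate models of `ZFC⁻` -/

section Operations

variable {κ : Cardinal.{u}}

instance : Inhabited (H (Order.succ κ)) := ⟨⟨∅, empty_mem_H⟩⟩

/-- A counterexample to `ψ` in `H(κ⁺)`, where the list holds the values of the bound variables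
followed by those of the free variables. -/
noncomputable def skolemOp {n : ℕ} (ψ : setLang.BoundedFormula ℕ (n + 1))
    (l : List (H (Order.succ κ))) : H (Order.succ κ) :=
  Classical.epsilon fun a =>
    ¬ ψ.Realize (fun k => l.getD (n + k) default) (Fin.snoc (fun i : Fin n => l.getD i default) a)

/-- The subset of the head of the list that `φ` defines in `H(κ⁺)`, with parameters in the tail. -/
noncomputable def sepOp (φ : setLang.Formula ℕ) (l : List (H (Order.succ κ))) :
    H (Order.succ κ) :=
  ⟨ZFSet.sep (fun x => ∃ hx : x ∈ H (Order.succ κ),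
    φ.Realize (Function.update (fun k => l.tail.getD k default) 0 ⟨x, hx⟩)) (l.headD default).1,
    mem_H_of_subset (l.headD default).2 ZFSet.sep_subset⟩

/-- A set that collects witnesses in `H(κ⁺)` for `φ` and the elements of the head of the list, with
parameters in the tail. -/
noncomputable def collOp (φ : setLang.Formula ℕ) (l : List (H (Order.succ κ))) :
    H (Order.succ κ) :=
  Classical.epsilon fun c => ∀ x : H (Order.succ κ), x.1 ∈ (l.headD default).1 →
    ∃ y : H (Order.succ κ), y.1 ∈ c.1 ∧
      φ.Realize (Function.update (Function.update (fun k => l.tail.getD k default) 0 x) 1 y)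

/-- The unordered pair of two sets in `H(κ⁺)`. -/
noncomputable def upairOp (κ : Cardinal.{u}) (x y : H (Order.succ κ)) : H (Order.succ κ) :=
  Classical.epsilon fun c => c.1 = {x.1, y.1}

/-- The union of a set in `H(κ⁺)`. -/
noncomputable def unionOp (x : H (Order.succ κ)) : H (Order.succ κ) :=
  ⟨ZFSet.sUnion x.1, sUnion_mem_H x.2⟩

/-- The intersection of two sets in `H(κ⁺)`. -/
noncomputable def interOp (x y : H (Order.succ κ)) : H (Order.succ κ) :=
  ⟨x.1 ∩ y.1, mem_H_of_subset x.2 fun _ h => (ZFSet.mem_inter.1 h).1⟩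

/-- `r` is a well-ordering of `a`. -/
def WellOrders (r a : ZFSet.{u}) : Prop :=
  (∀ x ∈ a, ZFSet.pair x x ∉ r) ∧
  (∀ x ∈ a, ∀ y ∈ a, ∀ z ∈ a, ZFSet.pair x y ∈ r → ZFSet.pair y z ∈ r → ZFSet.pair x z ∈ r) ∧
  (∀ x ∈ a, ∀ y ∈ a, ZFSet.pair x y ∈ r ∨ x = y ∨ ZFSet.pair y x ∈ r) ∧
  ∀ b ⊆ a, (∃ x, x ∈ b) → ∃ m ∈ b, ∀ x ∈ b, x = m ∨ ZFSet.pair m x ∈ r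

/-- A well-ordering in `H(κ⁺)`. -/
noncomputable def wellOrderOp (a : H (Order.succ κ)) : H (Order.succ κ) :=
  Classical.epsilon fun r => WellOrders r.1 a.1

/-- The operations that produce models of `ZFC⁻`, together with a given function `f`. -/
noncomputable def modelOps (f : Finset (H (Order.succ κ)) → H (Order.succ κ))
    (l : List (H (Order.succ κ))) : Set (H (Order.succ κ)) :=
  open Classical in
  {y | ∃ x ∈ l, y.1 ∈ x.1} ∪
    (Set.range (fun ψ : Σ n, setLang.BoundedFormula ℕ (n + 1) => skolemOp ψ.2 l) ∪
      Set.range (sepOp · l) ∪ Set.range (collOp · l) ∪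
      {upairOp κ (l.getD 0 default) (l.getD 1 default),
        interOp (l.getD 0 default) (l.getD 1 default), unionOp (l.getD 0 default),
        wellOrderOp (l.getD 0 default), f l.toFinset})

theorem mk_modelOps_le (hκ : ℵ₀ ≤ κ) (f : Finset (H (Order.succ κ)) → H (Order.succ κ))
    (l : List (H (Order.succ κ))) : #(modelOps f l) ≤ lift.{u + 1} κ := by
  have hκ' : ℵ₀ ≤ lift.{u + 1} κ := by simpa using hκ
  refine (Cardinal.mk_union_le _ _).trans (Cardinal.add_le_of_le hκ' ?_ ?_)
  · induction l with
    | nil => simp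
    | cons a l ih =>
      have : {y : H (Order.succ κ) | ∃ x ∈ a :: l, y.1 ∈ x.1} =
          {y | y.1 ∈ a.1} ∪ {y | ∃ x ∈ l, y.1 ∈ x.1} := by
        ext y; simp
      rw [this]
      refine (Cardinal.mk_union_le _ _).trans (Cardinal.add_le_of_le hκ' ?_ ih)
      refine le_trans ?_ (card_le_iff.1 (card_le_of_mem_H a.2))
      exact Cardinal.mk_le_of_injective
        (f := fun x => (⟨x.1.1, x.2⟩ : (a.1 : Set ZFSet.{u})))
        fun x y h => Subtype.ext (Subtype.ext (Subtype.mk.inj h))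
  · refine le_trans ?_ hκ'
    rw [Cardinal.le_aleph0_iff_set_countable]
    exact (((Set.countable_range _).union (Set.countable_range _)).union
      (Set.countable_range _)).union (Set.toFinite _).countable

/-- The operation is a choice rather than an explicit pair because the pair belongs to `H(κ⁺)` only
by virtue of `κ` being infinite. -/
theorem upairOp_val (hκ : ℵ₀ ≤ κ) (x y : H (Order.succ κ)) :
    (upairOp κ x y).1 = {x.1, y.1} :=
  Classical.epsilon_spec (p := fun c : H (Order.succ κ) => c.1 = {x.1, y.1})
    ⟨⟨_, upair_mem_H hκ x.2 y.2⟩, rfl⟩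

theorem exists_wellOrders (hκ : ℵ₀ ≤ κ) (a : H (Order.succ κ)) :
    ∃ r : H (Order.succ κ), WellOrders r.1 a.1 := by
  let R : a.1 → a.1 → Prop := WellOrderingRel
  let ι := {p : a.1 × a.1 // R p.1 p.2}
  have hι : #ι ≤ lift.{u + 1} κ := by
    have ha : #a.1 ≤ lift.{u + 1} κ := card_le_iff.1 (card_le_of_mem_H a.2)
    refine (Cardinal.mk_subtype_le _).trans ?_
    rw [Cardinal.mk_prod, Cardinal.lift_id]
    exact (mul_le_mul' ha ha).trans (Cardinal.mul_eq_self (by simpa using hκ)).le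
  have := small_of_mk_le_lift hι
  let r : ZFSet.{u} := ZFSet.range fun p : ι => ZFSet.pair p.1.1 p.1.2
  have hr : r ∈ H (Order.succ κ) := range_mem_H hκ hι fun p =>
    pair_mem_H hκ (mem_H_of_mem a.2 p.1.1.2) (mem_H_of_mem a.2 p.1.2.2)
  have hmem : ∀ {x y : ZFSet.{u}} (hx : x ∈ a.1) (hy : y ∈ a.1),
      ZFSet.pair x y ∈ r ↔ R ⟨x, hx⟩ ⟨y, hy⟩ := by
    intro x y hx hy
    simp only [r, ZFSet.mem_range]
    constructor
    · rintro ⟨⟨⟨⟨x', hx'⟩, ⟨y', hy'⟩⟩, h⟩, he⟩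
      obtain ⟨rfl, rfl⟩ := ZFSet.pair_inj.1 he
      exact h
    · intro h
      exact ⟨⟨⟨⟨x, hx⟩, ⟨y, hy⟩⟩, h⟩, rfl⟩
  refine ⟨⟨r, hr⟩, ?_, ?_, ?_, ?_⟩
  · intro x hx h
    exact irrefl_of WellOrderingRel _ ((hmem hx hx).1 h)
  · intro x hx y hy z hz h1 h2
    exact (hmem hx hz).2 (trans_of WellOrderingRel ((hmem hx hy).1 h1) ((hmem hy hz).1 h2))
  · intro x hx y hy
    rcases trichotomous_of WellOrderingRel (⟨x, hx⟩ : a.1) ⟨y, hy⟩ with h | h | h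
    · exact .inl ((hmem hx hy).2 h)
    · exact .inr (.inl (Subtype.mk.inj h))
    · exact .inr (.inr ((hmem hy hx).2 h))
  · rintro b hb ⟨x, hx⟩
    have hwf : WellFounded R := IsWellFounded.wf
    obtain ⟨m, hm, hmin⟩ := hwf.has_min {z : a.1 | z.1 ∈ b} ⟨⟨x, hb hx⟩, hx⟩
    refine ⟨m.1, hm, fun z hz => ?_⟩
    rcases trichotomous_of WellOrderingRel (⟨z, hb hz⟩ : a.1) m with h | h | h
    · exact absurd h (hmin _ hz)
    · exact .inl (congrArg Subtype.val h)
    · exact .inr ((hmem m.2 (hb hz)).2 h)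

/-- Collection holds in `H(κ⁺)`: one witness for each of the at most `κ` elements of the head gives
a set that is again in `H(κ⁺)`. -/
theorem collOp_spec (hκ : ℵ₀ ≤ κ) (φ : setLang.Formula ℕ) (l : List (H (Order.succ κ)))
    (h : ∀ x : H (Order.succ κ), x.1 ∈ (l.headD default).1 → ∃ y : H (Order.succ κ),
      φ.Realize (Function.update (Function.update (fun k => l.tail.getD k default) 0 x) 1 y)) :
    ∀ x : H (Order.succ κ), x.1 ∈ (l.headD default).1 →
      ∃ y : H (Order.succ κ), y.1 ∈ (collOp φ l).1 ∧
        φ.Realize (Function.update (Function.update (fun k => l.tail.getD k default) 0 x) 1 y) := by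
  refine Classical.epsilon_spec (p := fun c : H (Order.succ κ) =>
    ∀ x : H (Order.succ κ), x.1 ∈ (l.headD default).1 →
      ∃ y : H (Order.succ κ), y.1 ∈ c.1 ∧
        φ.Realize (Function.update (Function.update (fun k => l.tail.getD k default) 0 x) 1 y)) ?_
  choose y hy using h
  have hmem : ∀ x : (l.headD default).1, x.1 ∈ H (Order.succ κ) :=
    fun x => mem_H_of_mem (l.headD default).2 x.2
  refine ⟨⟨ZFSet.range fun x : (l.headD default).1 => (y ⟨x.1, hmem x⟩ x.2).1,
    range_mem_H hκ (card_le_iff.1 (card_le_of_mem_H (l.headD default).2)) fun x => (y _ _).2⟩,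
    fun x hx => ⟨y x hx, ZFSet.mem_range.2 ⟨⟨x.1, hx⟩, rfl⟩, hy x hx⟩⟩

end Operations

/-! ### Sets closed under the operations -/

section ClosedSets

variable {κ : Cardinal.{u}}

/-- `X` is closed under `D`. -/
def ClosedUnder (D : List (H (Order.succ κ)) → Set (H (Order.succ κ))) (X : ZFSet.{u}) : Prop :=
  ∀ l : List (H (Order.succ κ)), (∀ x ∈ l, x.1 ∈ X) → ∀ y ∈ D l, y.1 ∈ X

variable {f : Finset (H (Order.succ κ)) → H (Order.succ κ)} {X : ZFSet.{u}}

theorem ClosedUnder.isTransitive (hX : ClosedUnder (modelOps f) X)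
    (hH : (X : Set ZFSet.{u}) ⊆ H (Order.succ κ)) : X.IsTransitive := fun x hx y hy =>
  hX [⟨x, hH hx⟩] (by simpa using hx) ⟨y, mem_H_of_mem (hH hx) hy⟩
    (.inl ⟨_, List.mem_singleton_self _, hy⟩)

theorem ClosedUnder.upair_mem (hX : ClosedUnder (modelOps f) X) (hκ : ℵ₀ ≤ κ)
    (hH : (X : Set ZFSet.{u}) ⊆ H (Order.succ κ)) {x y : ZFSet.{u}} (hx : x ∈ X) (hy : y ∈ X) :
    ({x, y} : ZFSet.{u}) ∈ X := by
  have := hX [⟨x, hH hx⟩, ⟨y, hH hy⟩] (by simp [hx, hy]) (upairOp κ ⟨x, hH hx⟩ ⟨y, hH hy⟩)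
    (.inr (.inr (by simp)))
  rwa [upairOp_val hκ] at this

theorem ClosedUnder.inter_mem (hX : ClosedUnder (modelOps f) X)
    (hH : (X : Set ZFSet.{u}) ⊆ H (Order.succ κ)) {x y : ZFSet.{u}} (hx : x ∈ X) (hy : y ∈ X) :
    x ∩ y ∈ X :=
  hX [⟨x, hH hx⟩, ⟨y, hH hy⟩] (by simp [hx, hy]) (interOp ⟨x, hH hx⟩ ⟨y, hH hy⟩)
    (.inr (.inr (by simp)))

theorem ClosedUnder.sUnion_mem (hX : ClosedUnder (modelOps f) X)
    (hH : (X : Set ZFSet.{u}) ⊆ H (Order.succ κ)) {x : ZFSet.{u}} (hx : x ∈ X) :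
    (ZFSet.sUnion x) ∈ X :=
  hX [⟨x, hH hx⟩] (by simp [hx]) (unionOp ⟨x, hH hx⟩) (.inr (.inr (by simp)))

theorem ClosedUnder.exists_wellOrders (hX : ClosedUnder (modelOps f) X) (hκ : ℵ₀ ≤ κ)
    (hH : (X : Set ZFSet.{u}) ⊆ H (Order.succ κ)) {x : ZFSet.{u}} (hx : x ∈ X) :
    ∃ r ∈ X, WellOrders r x :=
  ⟨_, hX [⟨x, hH hx⟩] (by simp [hx]) (wellOrderOp ⟨x, hH hx⟩) (.inr (.inr (by simp))),
    Classical.epsilon_spec (p := fun r : H (Order.succ κ) => WellOrders r.1 x)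
      (FilterGame.exists_wellOrders hκ ⟨x, hH hx⟩)⟩

theorem ClosedUnder.apply_mem (hX : ClosedUnder (modelOps f) X) (s : Finset (H (Order.succ κ)))
    (hs : ∀ x ∈ s, x.1 ∈ X) : (f s).1 ∈ X :=
  hX s.toList (by simpa using hs) (f s) (.inr (.inr (by simp)))

/-- The inclusion of a subset of `H(κ⁺)`. -/
def inclH (hH : (X : Set ZFSet.{u}) ⊆ H (Order.succ κ)) (x : (X : Set ZFSet.{u})) :
    H (Order.succ κ) := ⟨x.1, hH x.2⟩

theorem term_realize_inclH (hH : (X : Set ZFSet.{u}) ⊆ H (Order.succ κ)) {α : Type}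
    (t : setLang.Term α) (p : α → (X : Set ZFSet.{u})) :
    t.realize (inclH hH ∘ p) = inclH hH (t.realize p) := by
  cases t with
  | var i => rfl
  | func f ts => exact Empty.elim f

/-- The Tarski–Vaught criterion: sets closed under the operations are elementary in `H(κ⁺)`. -/
theorem ClosedUnder.realize_iff (hX : ClosedUnder (modelOps f) X)
    (hH : (X : Set ZFSet.{u}) ⊆ H (Order.succ κ)) {n : ℕ} (φ : setLang.BoundedFormula ℕ n)
    (p : ℕ → (X : Set ZFSet.{u})) (v : Fin n → (X : Set ZFSet.{u})) :
    φ.Realize p v ↔ φ.Realize (inclH hH ∘ p) (inclH hH ∘ v) := by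
  induction φ with
  | falsum => exact Iff.rfl
  | equal t₁ t₂ =>
    simp only [BoundedFormula.Realize]
    rw [← Sum.comp_elim, term_realize_inclH, term_realize_inclH]
    exact ⟨fun h => congrArg _ h, fun h => Subtype.ext (Subtype.mk.inj h)⟩
  | rel R ts =>
    simp only [BoundedFormula.Realize]
    rw [← Sum.comp_elim]
    simp only [term_realize_inclH]
    cases R
    exact Iff.rfl
  | imp φ ψ h₁ h₂ =>
    simp only [BoundedFormula.Realize]
    rw [h₁, h₂]
  | @all n φ ih =>
    simp only [BoundedFormula.Realize]
    have hsnoc : ∀ a, inclH hH ∘ (Fin.snoc v a : Fin (n + 1) → (X : Set ZFSet.{u})) =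
        Fin.snoc (inclH hH ∘ v) (inclH hH a) := fun a => by
      rw [Fin.comp_snoc]
    constructor
    · intro h
      by_contra hcon
      push Not at hcon
      -- A Skolem operation takes a finite list, so the infinite assignment `p` is cut off at a
      -- bound `N` beyond which it has no effect on `φ`.
      obtain ⟨N, hN⟩ := exists_bound_realize φ
      let l : List (H (Order.succ κ)) :=
        List.ofFn (inclH hH ∘ v) ++ List.ofFn fun k : Fin N => inclH hH (p k)
      have hv : (fun i : Fin n => l.getD i default) = inclH hH ∘ v := by
        funext i
        simp [l, List.getD_eq_getElem?_getD, List.getElem?_append]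
      have hp : ∀ k < N, l.getD (n + k) default = (inclH hH ∘ p) k := by
        intro k hk
        simp [l, List.getD_eq_getElem?_getD, hk]
      have hl : ∀ x ∈ l, x.1 ∈ X := by
        intro x hx
        simp only [l, List.mem_append, List.mem_ofFn] at hx
        rcases hx with ⟨i, rfl⟩ | ⟨i, rfl⟩
        · exact (v i).2
        · exact (p i).2
      have hsk : ¬ φ.Realize (inclH hH ∘ p) (Fin.snoc (inclH hH ∘ v) (skolemOp φ l)) := by
        have : ¬ φ.Realize (fun k => l.getD (n + k) default)
            (Fin.snoc (fun i : Fin n => l.getD i default) (skolemOp φ l)) :=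
          Classical.epsilon_spec (p := fun a => ¬ φ.Realize
            (fun k => l.getD (n + k) default) (Fin.snoc (fun i : Fin n => l.getD i default) a)) (by
              obtain ⟨a, ha⟩ := hcon
              refine ⟨a, ?_⟩
              rwa [hv, hN _ (inclH hH ∘ p) _ hp])
        rwa [hN _ (inclH hH ∘ p) _ hp, hv] at this
      have hmem : (skolemOp φ l).1 ∈ X :=
        hX l hl _ (.inr (.inl (.inl (.inl ⟨⟨n, φ⟩, rfl⟩))))
      have := (ih (Fin.snoc v ⟨_, hmem⟩)).1 (h _)
      rw [hsnoc] at this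
      exact hsk this
    · intro h a
      rw [ih, hsnoc]
      exact h _

/-- Transitivity makes the elements seen by the structure the true ones; closure under pairs is
needed so that `{x}` and `{x, y}` are themselves seen. -/
theorem isPair_iff (hX : X.IsTransitive)
    (hpair : ∀ x ∈ X, ∀ y ∈ X, ({x, y} : ZFSet.{u}) ∈ X) {p x y : (X : Set ZFSet.{u})} :
    IsPair p x y ↔ p.1 = ZFSet.pair x.1 y.1 := by
  have h1 : ∀ z : (X : Set ZFSet.{u}), (∀ w, E w z ↔ w = x) ↔ z.1 = {x.1} := by
    intro z
    constructor
    · intro h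
      ext w
      rw [ZFSet.mem_singleton]
      exact ⟨fun hw => congrArg Subtype.val ((h ⟨w, hX _ z.2 hw⟩).1 hw),
        fun hw => (h ⟨w, hw ▸ x.2⟩).2 (Subtype.ext hw)⟩
    · intro h w
      rw [E_iff, h, ZFSet.mem_singleton, Subtype.ext_iff]
  have h2 : ∀ z : (X : Set ZFSet.{u}), (∀ w, E w z ↔ w = x ∨ w = y) ↔ z.1 = {x.1, y.1} := by
    intro z
    constructor
    · intro h
      ext w
      rw [ZFSet.mem_pair]
      constructor
      · intro hw
        exact ((h ⟨w, hX _ z.2 hw⟩).1 hw).imp (congrArg Subtype.val) (congrArg Subtype.val)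
      · rintro (hw | hw)
        · exact (h ⟨w, hw ▸ x.2⟩).2 (.inl (Subtype.ext hw))
        · exact (h ⟨w, hw ▸ y.2⟩).2 (.inr (Subtype.ext hw))
    · intro h w
      rw [E_iff, h, ZFSet.mem_pair, Subtype.ext_iff, Subtype.ext_iff]
  unfold IsPair
  simp only [h1, h2]
  constructor
  · intro h
    ext z
    simp only [ZFSet.pair, ZFSet.mem_pair]
    constructor
    · intro hz
      exact (h ⟨z, hX _ p.2 hz⟩).1 hz
    · intro hz
      have : z ∈ X := by
        rcases hz with rfl | rfl
        · rw [← ZFSet.pair_eq_singleton]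
          exact hpair _ x.2 _ x.2
        · exact hpair _ x.2 _ y.2
      exact (h ⟨z, this⟩).2 hz
  · intro h z
    rw [E_iff, h]
    simp [ZFSet.pair]

theorem pairMem_iff (hX : X.IsTransitive)
    (hpair : ∀ x ∈ X, ∀ y ∈ X, ({x, y} : ZFSet.{u}) ∈ X) {r x y : (X : Set ZFSet.{u})} :
    PairMem r x y ↔ ZFSet.pair x.1 y.1 ∈ r.1 := by
  constructor
  · rintro ⟨p, hp, hr⟩
    rw [isPair_iff hX hpair] at hp
    exact hp ▸ hr
  · intro h
    exact ⟨⟨_, hX _ r.2 h⟩, (isPair_iff hX hpair).2 rfl, h⟩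

theorem ClosedUnder.modelsZFCMinus (hX : ClosedUnder (modelOps f) X) (hκ : ℵ₀ ≤ κ)
    (hH : (X : Set ZFSet.{u}) ⊆ H (Order.succ κ)) (hk : kset κ ∈ X) :
    ModelsZFCMinus (X : Set ZFSet.{u}) := by
  have htr := hX.isTransitive hH
  have hpair : ∀ x ∈ X, ∀ y ∈ X, ({x, y} : ZFSet.{u}) ∈ X :=
    fun x hx y hy => hX.upair_mem hκ hH hx hy
  have hform : ∀ (φ : setLang.Formula ℕ) (p : ℕ → (X : Set ZFSet.{u})),
      φ.Realize p ↔ φ.Realize (inclH hH ∘ p) := by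
    intro φ p
    refine (hX.realize_iff hH φ p default).trans ?_
    rw [Unique.eq_default (inclH hH ∘ default)]
    rfl
  -- a finite list of parameters suffices
  have hlist : ∀ (φ : setLang.Formula ℕ) (a : (X : Set ZFSet.{u})) (p : ℕ → (X : Set ZFSet.{u})),
      ∃ l : List (H (Order.succ κ)), (∀ x ∈ l, x.1 ∈ X) ∧ l.headD default = inclH hH a ∧
        (∀ x, φ.Realize (Function.update (fun k => l.tail.getD k default) 0 x) ↔
          φ.Realize (Function.update (inclH hH ∘ p) 0 x)) ∧
        ∀ x y, φ.Realize (Function.update (Function.update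
            (fun k => l.tail.getD k default) 0 x) 1 y) ↔
          φ.Realize (Function.update (Function.update (inclH hH ∘ p) 0 x) 1 y) := by
    intro φ a p
    obtain ⟨N, hN⟩ := exists_bound_realize φ
    have hget : ∀ k < N, (List.ofFn fun k : Fin N => inclH hH (p k)).getD k default =
        (inclH hH ∘ p) k := by
      intro k hk
      simp [List.getD_eq_getElem?_getD, hk]
    refine ⟨inclH hH a :: List.ofFn fun k : Fin N => inclH hH (p k), ?_, rfl, ?_, ?_⟩
    · intro x hx
      simp only [List.mem_cons, List.mem_ofFn] at hx
      rcases hx with rfl | ⟨i, rfl⟩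
      · exact a.2
      · exact (p i).2
    · intro x
      refine hN _ _ _ fun k hk => ?_
      simp only [Function.update_apply, List.tail_cons, hget k hk]
    · intro x y
      refine hN _ _ _ fun k hk => ?_
      simp only [Function.update_apply, List.tail_cons, hget k hk]
  refine ⟨?_, ?_, ?_, ?_, ?_, ?_, ?_, ?_⟩
  · intro a b h
    refine Subtype.ext (ZFSet.ext fun z => ⟨fun hz => ?_, fun hz => ?_⟩)
    · exact (h ⟨z, htr _ a.2 hz⟩).1 hz
    · exact (h ⟨z, htr _ b.2 hz⟩).2 hz
  · rintro a ⟨x, hx⟩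
    obtain ⟨y, hy, he⟩ := ZFSet.regularity a.1 (by rintro h; rw [E_iff, h] at hx; simp at hx)
    refine ⟨⟨y, htr _ a.2 hy⟩, hy, fun z hz hza => ?_⟩
    have : z.1 ∈ a.1 ∩ y := ZFSet.mem_inter.2 ⟨hza, hz⟩
    simp [he] at this
  · intro a b
    exact ⟨⟨_, hpair _ a.2 _ b.2⟩, fun x => by
      rw [E_iff, ZFSet.mem_pair, Subtype.ext_iff, Subtype.ext_iff]⟩
  · intro a
    refine ⟨⟨_, hX.sUnion_mem hH a.2⟩, fun x => ?_⟩
    rw [E_iff, ZFSet.mem_sUnion]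
    constructor
    · rintro ⟨y, hy, hxy⟩
      exact ⟨⟨y, htr _ a.2 hy⟩, hy, hxy⟩
    · rintro ⟨y, hy, hxy⟩
      exact ⟨y.1, hy, hxy⟩
  -- The inductive set is `κ` itself, a limit ordinal.
  · have hlim := Cardinal.isSuccLimit_ord hκ
    have hmem : ∀ α < κ.ord, α.toZFSet ∈ kset κ := fun α hα =>
      Ordinal.toZFSet_mem_toZFSet_iff.2 hα
    have h0 := hmem 0 (by simpa using hlim.bot_lt)
    refine ⟨⟨_, hk⟩, ⟨⟨_, htr _ hk h0⟩, h0, fun x => ?_⟩, fun x hx => ?_⟩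
    · change x.1 ∉ Ordinal.toZFSet 0
      rw [Ordinal.toZFSet_zero]
      exact ZFSet.notMem_empty _
    · obtain ⟨α, hα, hx⟩ := Ordinal.mem_toZFSet_iff.1 hx
      have h1 := hmem (α + 1) (succ_lt_ord hκ hα)
      refine ⟨⟨_, htr _ hk h1⟩, h1, fun z => ?_⟩
      simp only [E_iff]
      rw [Ordinal.toZFSet_add_one, ZFSet.mem_insert_iff, hx, Subtype.ext_iff, or_comm]
      exact Iff.rfl
  · intro φ p a
    obtain ⟨l, hl, ha, hφ, -⟩ := hlist φ a p
    have hc : (sepOp φ l).1 ∈ X := hX l hl _ (.inr (.inl (.inl (.inr ⟨φ, rfl⟩))))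
    refine ⟨⟨_, hc⟩, fun x => ?_⟩
    rw [hform, Function.comp_update, E_iff]
    simp only [sepOp, mem_sep', ha, hφ]
    exact and_congr Iff.rfl ⟨fun ⟨_, h⟩ => h, fun h => ⟨hH x.2, h⟩⟩
  · intro φ p a h
    obtain ⟨l, hl, ha, -, hφ⟩ := hlist φ a p
    have hc : (collOp φ l).1 ∈ X := hX l hl _ (.inr (.inl (.inr ⟨φ, rfl⟩)))
    have := collOp_spec hκ φ l (by
      intro x hx
      rw [ha] at hx
      obtain ⟨y, hy⟩ := h ⟨x.1, htr _ a.2 hx⟩ hx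
      rw [hform, Function.comp_update, Function.comp_update] at hy
      exact ⟨inclH hH y, (hφ _ _).2 hy⟩)
    refine ⟨⟨_, hc⟩, fun x hx => ?_⟩
    obtain ⟨y, hy, hφy⟩ := this (inclH hH x) (by rw [ha]; exact hx)
    refine ⟨⟨y.1, htr _ hc hy⟩, hy, ?_⟩
    rw [hform, Function.comp_update, Function.comp_update]
    exact (hφ _ _).1 hφy
  · intro a
    obtain ⟨r, hr, h1, h2, h3, h4⟩ := hX.exists_wellOrders hκ hH a.2
    refine ⟨⟨r, hr⟩, ?_⟩
    simp only [pairMem_iff htr hpair, E_iff, Subtype.ext_iff]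
    refine ⟨fun x hx => h1 _ hx, fun x y z hx hy hz => h2 _ hx _ hy _ hz,
      fun x y hx hy => h3 _ hx _ hy, fun b hb hne => ?_⟩
    obtain ⟨m, hm, hmin⟩ := h4 b.1 (fun x hx => hb ⟨x, htr _ b.2 hx⟩ hx)
      (hne.imp' Subtype.val fun x hx => hx)
    exact ⟨⟨m, htr _ b.2 hm⟩, hm, fun x hx => hmin _ hx⟩

end ClosedSets

/-! ### From the game to stationarily many models -/

section Forward

variable {κ : Cardinal.{u}}

/-- The suitable models of size at most `κ` that are closed under the model operations and `f`. -/
structure IsGood (κ : Cardinal.{u}) (f : Finset (H (Order.succ κ)) → H (Order.succ κ))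
    (N : ZFSet.{u}) : Prop where
  suitable : IsSuitable κ N
  card_le : N.card ≤ κ
  closedUnder : ClosedUnder (modelOps f) N

theorem IsGood.mem_H {f : Finset (H (Order.succ κ)) → H (Order.succ κ)} {N : ZFSet.{u}}
    (h : IsGood κ f N) : N ∈ H (Order.succ κ) :=
  mem_H_of_isTransitive h.suitable.transitive h.card_le

theorem exists_isGood (hreg : κ.IsRegular) (hpow : κ ^< κ = κ)
    (f : Finset (H (Order.succ κ)) → H (Order.succ κ)) (X : ZFSet.{u}) (hc : X.card ≤ κ)
    (hX : ∀ x ∈ X, x ∈ H (Order.succ κ)) : ∃ N, X ⊆ N ∧ IsGood κ f N := by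
  have hκ := hreg.aleph0_le
  obtain ⟨N, hXN, hNc, hNH, hND, hNs⟩ := exists_closed_zfset hreg hpow (modelOps f)
    (mk_modelOps_le hκ f) (insert (kset κ) X)
    (ZFSet.card_insert_le.trans (Cardinal.add_le_of_le hκ hc (Cardinal.one_le_aleph0.trans hκ)))
    (by
      intro x hx
      rcases ZFSet.mem_insert_iff.1 hx with rfl | hx
      exacts [kset_mem_H, hX x hx])
  have hk : kset κ ∈ N := hXN (ZFSet.mem_insert _ _)
  have hcl : ClosedUnder (modelOps f) N := hND
  exact ⟨N, fun x hx => hXN (ZFSet.mem_insert_of_mem _ hx),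
    ⟨hcl.isTransitive hNH, hNH, hk, hcl.modelsZFCMinus hκ hNH hk, hNs⟩, hNc, hcl⟩

theorem seqSet_congr {α : Ordinal.{u}} {f g : Ordinal.{u} → ZFSet.{u}}
    (h : ∀ ξ < α, f ξ = g ξ) : seqSet α f = seqSet α g := by
  ext x
  simp only [mem_seqSet]
  exact exists_congr fun ξ => and_congr_right fun hξ => by rw [h ξ hξ]

/-- The trace of a filter on `M`, as a set. -/
noncomputable def traceSet (F : Filter (kset κ)) (M : ZFSet.{u}) : ZFSet.{u} :=
  ZFSet.sep (· ∈ trace κ F M) M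

/-- What the next model played by Player I has to include. -/
noncomputable def requirement (i : Ordinal.{u})
    (m : Set.Iio i → ZFSet.{u} × Filter (kset κ)) : ZFSet.{u} :=
  open Classical in
  insert (seqSet i fun ξ => if h : ξ < i then (m ⟨ξ, h⟩).1 else ∅)
    ((ZFSet.iUnion fun j => (m j).1) ∪ ZFSet.range fun j => traceSet (m j).2 (m j).1)

/-- The strategy of Player I that plays good models that include the requirements. -/
noncomputable def goodStrategy (f : Finset (H (Order.succ κ)) → H (Order.succ κ)) : StrategyI κ :=
  fun i m => Classical.epsilon fun N => requirement i m ⊆ N ∧ IsGood κ f N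

section Requirement

variable {M : Ordinal.{u} → ZFSet.{u}} {F : Ordinal.{u} → Filter (kset κ)} {i : Ordinal.{u}}

theorem mem_requirement {x : ZFSet.{u}} :
    x ∈ requirement i (fun j => (M j.1, F j.1)) ↔
      x = seqSet i M ∨ (∃ j < i, x ∈ M j) ∨ ∃ j < i, traceSet (F j) (M j) = x := by
  have : seqSet i (fun ξ => if ξ < i then M ξ else ∅) = seqSet i M :=
    seqSet_congr fun ξ hξ => by simp [hξ]
  simp [requirement, this]

/-- The choice made by the strategy is meaningful only if the requirement is a subset of `H(κ⁺)` of
size at most `κ`, which rests on the goodness of the earlier models; hence the induction. The moves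
of Player II may be arbitrary here, since the trace on a model is in any case a subset of that
model. -/
theorem requirement_subset_and_isGood (hreg : κ.IsRegular) (hpow : κ ^< κ = κ)
    {f : Finset (H (Order.succ κ)) → H (Order.succ κ)} (hi : i < (Order.succ κ).ord)
    (h : ∀ j ≤ i, (goodStrategy f).Follows M F j) :
    requirement i (fun j => (M j.1, F j.1)) ⊆ M i ∧ IsGood κ f (M i) := by
  have hκ := hreg.aleph0_le
  induction i using WellFoundedLT.induction with
  | ind i ih =>
    have hgood : ∀ j < i, IsGood κ f (M j) := fun j hj =>
      (ih j hj (hj.trans hi) fun k hk => h k (hk.trans hj.le)).2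
    have hIio : #(Set.Iio i) ≤ lift.{u + 1} κ := by
      rw [Cardinal.mk_Iio_ordinal, Cardinal.lift_le]
      exact card_le_of_lt_succ_ord hi
    have hf : M i = goodStrategy f i fun j => (M j.1, F j.1) := h i le_rfl
    rw [hf]
    refine Classical.epsilon_spec (p := fun N =>
      requirement i (fun j => (M j.1, F j.1)) ⊆ N ∧ IsGood κ f N)
      (exists_isGood hreg hpow f _ ?_ ?_)
    · refine ZFSet.card_insert_le.trans (Cardinal.add_le_of_le hκ ?_
        (Cardinal.one_le_aleph0.trans hκ))
      refine ZFSet.card_union_le.trans (Cardinal.add_le_of_le hκ ?_ (card_range_le hIio))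
      rw [card_le_iff, ZFSet.coe_iUnion]
      refine (Cardinal.mk_iUnion_le_sum_mk.trans
        (Cardinal.sum_le_sum _ (fun _ => lift.{u + 1} κ)
          fun j : Set.Iio i => card_le_iff.1 (hgood j.1 j.2).card_le)).trans ?_
      rw [Cardinal.sum_const']
      exact (mul_le_mul_left hIio _).trans (Cardinal.mul_eq_self (by simpa using hκ)).le
    · intro x hx
      rcases mem_requirement.1 hx with rfl | ⟨j, hj, hx⟩ | ⟨j, hj, rfl⟩
      · exact seqSet_mem_H hκ hi fun ξ hξ => (hgood ξ hξ).mem_H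
      · exact (hgood j hj).suitable.subset_H hx
      · exact mem_H_of_subset (hgood j hj).mem_H ZFSet.sep_subset

end Requirement

/-! ### Coherence of the traces along a play -/

theorem trace_mono {F G : Filter (kset κ)} {M N : ZFSet.{u}} (hF : G ≤ F) (hM : M ⊆ N) :
    trace κ F M ⊆ trace κ G N :=
  fun _ hA => ⟨hM hA.1, hA.2.1, hF hA.2.2⟩

/-- An ultrafilter on the smaller model has already decided `A`; had it chosen the complement, the
later filter would contain both. So later moves never add sets of an earlier model. -/
theorem mem_trace_of_mem {F G : Filter (kset κ)} {M N A : ZFSet.{u}} (hF : G ≤ F) (hM : M ⊆ N)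
    (hFM : IsMUltrafilter M (kset κ) (trace κ F M))
    (hGN : IsMUltrafilter N (kset κ) (trace κ G N)) (hA : A ∈ M) (hAG : A ∈ trace κ G N) :
    A ∈ trace κ F M := by
  rcases hFM.mem_or_compl_mem A hA hAG.2.1 with h | h
  · exact h
  · refine absurd (hGN.inter_mem _ hAG _ (trace_mono hF hM h)) ?_
    have : A ∩ (kset κ \ A) = ∅ := by
      rw [ZFSet.eq_empty]
      intro y
      simp only [ZFSet.mem_inter, ZFSet.mem_sdiff]
      tauto
    rw [this]
    exact hGN.empty_notMem

theorem card_eq_of_mem_trace {F : Filter (kset κ)} {M A : ZFSet.{u}}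
    (hF : ∀ s ∈ F, #s = lift.{u + 1} κ) (hA : A ∈ trace κ F M) : A.card = κ := by
  have h := hF _ hA.2.2
  rw [← Cardinal.lift_inj.{u, u + 1}, ← ZFSet.cardinalMk_coe_sort, ← h]
  exact Cardinal.mk_congr
    ⟨fun x => ⟨⟨x.1, hA.2.1 x.2⟩, x.2⟩, fun x => ⟨x.1.1, x.2⟩, fun _ => rfl, fun _ => rfl⟩

theorem isStationary_of_not_winning (hreg : κ.IsRegular) (hpow : κ ^< κ = κ)
    (hwin : ¬ PlayerIHasWinningStrategy κ (filterConstraint κ) (Order.succ κ).ord) :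
    IsStationary (H (Order.succ κ))
      {M | IsSuitable κ M ∧ IsInternallyApproachable κ M ∧
        ∃ U : Set ZFSet.{u}, IsMUltrafilter M (kset κ) U ∧ IsComplete κ (kset κ) U ∧
          IsUniform κ U ∧ IsAmenable κ M (kset κ) U} := by
  intro f
  have hκ := hreg.aleph0_le
  have hreg' : (Order.succ κ).IsRegular := Cardinal.isRegular_succ hκ
  have hplay : ∃ (M : Ordinal.{u} → ZFSet.{u}) (F : Ordinal.{u} → Filter (kset κ)),
      ∀ i < (Order.succ κ).ord, (goodStrategy f).Follows M F i ∧
        LegalII κ (filterConstraint κ) M F i := by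
    by_contra hcon
    -- If no play against the strategy survived, it would be winning, because its moves are always
    -- legal.
    refine hwin ⟨goodStrategy f, ?_, hcon⟩
    intro M F i hi hj hfol
    obtain ⟨hsub, hgood⟩ := requirement_subset_and_isGood (f := f) (M := M) (F := F) hreg hpow hi
      fun j hji => hji.eq_or_lt.elim (fun h => h ▸ hfol) fun h => (hj j h).1
    refine ⟨hgood.suitable, hgood.card_le.trans ?_, fun j hji x hx =>
      hsub (mem_requirement.2 (.inr (.inl ⟨j, hji, hx⟩)))⟩
    exact le_mul_of_one_le_right' (le_max_left _ _)
  obtain ⟨M, F, hMF⟩ := hplay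
  have hM : ∀ i < (Order.succ κ).ord, requirement i (fun j => (M j.1, F j.1)) ⊆ M i ∧
      IsGood κ f (M i) := fun i hi => requirement_subset_and_isGood hreg hpow hi
    fun j hj => (hMF j (hj.trans_lt hi)).1
  have hmono : ∀ {j i}, j ≤ i → i < (Order.succ κ).ord → M j ⊆ M i := by
    intro j i hji hi
    rcases hji.eq_or_lt with rfl | hji
    · exact fun _ h => h
    · exact fun x hx => (hM i hi).1 (mem_requirement.2 (.inr (.inl ⟨j, hji, hx⟩)))
  have hFmono : ∀ {j i}, j ≤ i → i < (Order.succ κ).ord → F i ≤ F j := by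
    intro j i hji hi
    rcases hji.eq_or_lt with rfl | hji
    · exact le_rfl
    · exact (hMF i hi).2.2 j hji
  have hult : ∀ i < (Order.succ κ).ord, IsMUltrafilter (M i) (kset κ) (trace κ (F i) (M i)) :=
    fun i hi => (hMF i hi).2.1.2.2.1
  let T : ZFSet.{u} := ZFSet.iUnion fun i : Set.Iio (Order.succ κ).ord => M i.1
  have hT : ∀ {x}, x ∈ T ↔ ∃ i < (Order.succ κ).ord, x ∈ M i := by
    intro x
    simp [T]
  have hTH : (T : Set ZFSet.{u}) ⊆ H (Order.succ κ) := by
    intro x hx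
    obtain ⟨i, hi, hx⟩ := hT.1 hx
    exact (hM i hi).2.suitable.subset_H hx
  -- few elements of the union belong to one of the models
  have hbdd : ∀ {ι : Type (u + 1)} (x : ι → ZFSet.{u}), #ι < lift.{u + 1} (Order.succ κ) →
      (∀ k, x k ∈ T) → ∃ i < (Order.succ κ).ord, ∀ k, x k ∈ M i := by
    intro ι x hι hx
    choose g hg hgx using fun k => hT.1 (hx k)
    obtain ⟨i, hi, hle⟩ := exists_lt_ord_forall_le hreg' hι g hg
    exact ⟨i, hi, fun k => hmono (hle k) hi (hgx k)⟩
  have hpos : (0 : Ordinal.{u}) < (Order.succ κ).ord := hreg'.ord_pos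
  have hcl : ClosedUnder (modelOps f) T := by
    intro l hl y hy
    obtain ⟨i, hi, h⟩ := hbdd (fun x : {x // x ∈ l} => x.1.1) (by
        have : Finite {x // x ∈ l} := (List.finite_toSet l).to_subtype
        exact (Cardinal.lt_aleph0_of_finite _).trans_le
          (Cardinal.aleph0_le_lift.2 (hκ.trans (Order.le_succ κ)))) fun x => hl x.1 x.2
    exact hT.2 ⟨i, hi, (hM i hi).2.closedUnder l (fun x hx => h ⟨x, hx⟩) y hy⟩
  have hk : kset κ ∈ T := hT.2 ⟨0, hpos, (hM 0 hpos).2.suitable.card_mem⟩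
  have hTs : IsSuitable κ T := by
    refine ⟨hcl.isTransitive hTH, hTH, hk, hcl.modelsZFCMinus hκ hTH hk, ?_⟩
    intro α hα g hg
    obtain ⟨i, hi, h⟩ := hbdd (fun ξ : Set.Iio α => g ξ.1)
      (mk_Iio_lt_lift (hα.trans ord_lt_succ_ord)) fun ξ => hg _ ξ.2
    exact hT.2 ⟨i, hi, (hM i hi).2.suitable.closed α hα g fun ξ hξ => h ⟨ξ, hξ⟩⟩
  let U : Set ZFSet.{u} := {A | ∃ i < (Order.succ κ).ord, A ∈ trace κ (F i) (M i)}
  have htr : ∀ {j i A}, j ≤ i → i < (Order.succ κ).ord → A ∈ trace κ (F j) (M j) →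
      A ∈ trace κ (F i) (M i) := fun hji hi hA =>
    trace_mono (hFmono hji hi) (hmono hji hi) hA
  -- Membership in `U` of a set in `M i` is settled at stage `i`. Completeness and amenability of
  -- `U` both reduce to this.
  have hUM : ∀ {i A}, i < (Order.succ κ).ord → A ∈ M i → A ∈ U → A ∈ trace κ (F i) (M i) := by
    rintro i A hi hA ⟨k, hk, hAk⟩
    have hm := max_lt hi hk
    exact mem_trace_of_mem (hFmono (le_max_left i k) hm) (hmono (le_max_left i k) hm) (hult i hi)
      (hult _ hm) hA (htr (le_max_right i k) hm hAk)
  refine ⟨T, ⟨hTs, ⟨M, fun α hα => (hM α hα).2.suitable, fun x => hT, fun β hβ =>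
    (hM β hβ).1 (mem_requirement.2 (.inl rfl))⟩, U, ⟨?_, ?_, ?_, ?_, ?_, ?_⟩, ?_, ?_, ?_⟩, hTH,
    fun s hs => hcl.apply_mem s hs⟩
  · rintro A ⟨i, hi, hA⟩
    exact ⟨hT.2 ⟨i, hi, hA.1⟩, hA.2.1⟩
  · exact ⟨0, hpos, (hult 0 hpos).whole_mem⟩
  · rintro ⟨i, hi, hA⟩
    exact (hult i hi).empty_notMem hA
  · rintro A ⟨i, hi, hA⟩ B ⟨j, hj, hB⟩
    have hm := max_lt hi hj
    exact ⟨_, hm, (hult _ hm).inter_mem _ (htr (le_max_left i j) hm hA) _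
      (htr (le_max_right i j) hm hB)⟩
  · rintro A ⟨i, hi, hA⟩ B hB hBX hAB
    obtain ⟨j, hj, hB⟩ := hT.1 hB
    have hm := max_lt hi hj
    exact ⟨_, hm, (hult _ hm).mem_of_superset _ (htr (le_max_left i j) hm hA) _
      (hmono (le_max_right i j) hm hB) hBX hAB⟩
  · intro A hA hAX
    obtain ⟨i, hi, hA⟩ := hT.1 hA
    exact ((hult i hi).mem_or_compl_mem A hA hAX).imp (fun h => ⟨i, hi, h⟩) fun h => ⟨i, hi, h⟩
  · intro S hSU hS
    obtain ⟨i, hi, h⟩ := hbdd (fun A : S => A.1)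
      (hS.trans_le (Cardinal.lift_le.2 (Order.le_succ κ))) fun A => by
        obtain ⟨i, hi, hA⟩ := hSU A.2
        exact hT.2 ⟨i, hi, hA.1⟩
    exact (hMF i hi).2.1.2.2.2 S (fun A hA => hUM hi (h ⟨A, hA⟩) (hSU hA)) hS
  · rintro A ⟨i, hi, hA⟩
    exact card_eq_of_mem_trace (hMF i hi).2.1.2.1 hA
  · intro 𝒜 h𝒜 _ _
    obtain ⟨i, hi, h𝒜⟩ := hT.1 h𝒜
    have hi' := succ_lt_ord hreg'.aleph0_le hi
    -- Since `M i` is transitive, `𝒜 ⊆ M i`, so the trace at stage `i` decides all of `𝒜`; that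
    -- trace is an element of `M (i + 1)`.
    have heq : ZFSet.sep (· ∈ U) 𝒜 = 𝒜 ∩ traceSet (F i) (M i) := by
      ext A
      simp only [mem_sep', ZFSet.mem_inter, traceSet]
      refine and_congr_right fun hA => ?_
      have hAM := (hM i hi).2.suitable.transitive _ h𝒜 hA
      exact ⟨fun h => ⟨hAM, hUM hi hAM h⟩, fun h => ⟨i, hi, h.2⟩⟩
    rw [heq]
    refine hT.2 ⟨i + 1, hi', (hM _ hi').2.closedUnder.inter_mem (hM _ hi').2.suitable.subset_H
      (hmono (le_of_lt (lt_add_one i)) hi' h𝒜)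
      ((hM _ hi').1 (mem_requirement.2 (.inr (.inr ⟨i, lt_add_one i, rfl⟩))))⟩

end Forward

/-! ### Elementary closure properties of suitable models -/

section Suitable

variable {κ : Cardinal.{u}} {M : ZFSet.{u}}

theorem IsSuitable.upair_mem (hM : IsSuitable κ M) {x y : ZFSet.{u}} (hx : x ∈ M) (hy : y ∈ M) :
    ({x, y} : ZFSet.{u}) ∈ M := by
  obtain ⟨c, hc⟩ := hM.models.pairing ⟨x, hx⟩ ⟨y, hy⟩
  have : c.1 = {x, y} := by
    ext z
    rw [ZFSet.mem_pair]
    constructor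
    · intro hz
      exact ((hc ⟨z, hM.transitive _ c.2 hz⟩).1 hz).imp Subtype.mk.inj Subtype.mk.inj
    · rintro (rfl | rfl)
      · exact (hc ⟨z, hx⟩).2 (.inl rfl)
      · exact (hc ⟨z, hy⟩).2 (.inr rfl)
  exact this ▸ c.2

theorem IsSuitable.pair_mem (hM : IsSuitable κ M) {x y : ZFSet.{u}} (hx : x ∈ M) (hy : y ∈ M) :
    ZFSet.pair x y ∈ M := by
  refine hM.upair_mem ?_ (hM.upair_mem hx hy)
  rw [← ZFSet.pair_eq_singleton]
  exact hM.upair_mem hx hx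

/-- The formula `v₀ ∈ v₁`. -/
def memFormula : setLang.Formula ℕ :=
  Relations.formula₂ (MemRel.mem : setLang.Relations 2) (Term.var 0) (Term.var 1)

theorem realize_memFormula {X : Set ZFSet.{u}} {p : ℕ → X} :
    memFormula.Realize p ↔ (p 0).1 ∈ (p 1).1 :=
  Formula.realize_rel₂.trans Iff.rfl

/-- Separation with the constant assignment `y`: the schema overwrites only the variable `0`, so the
variable `1` still denotes `y`. -/
theorem IsSuitable.sep_mem_of_formula (hM : IsSuitable κ M) {x y : ZFSet.{u}} (hx : x ∈ M)
    (hy : y ∈ M) (φ : setLang.Formula ℕ) (P : ZFSet.{u} → Prop)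
    (h : ∀ p : ℕ → (M : Set ZFSet.{u}), (p 1).1 = y → (φ.Realize p ↔ P (p 0).1)) :
    ZFSet.sep P x ∈ M := by
  obtain ⟨c, hc⟩ := hM.models.separation φ (fun _ => ⟨y, hy⟩) ⟨x, hx⟩
  have : c.1 = ZFSet.sep P x := by
    ext z
    rw [mem_sep']
    constructor
    · intro hz
      obtain ⟨h1, h2⟩ := (hc ⟨z, hM.transitive _ c.2 hz⟩).1 hz
      exact ⟨h1, by simpa using (h _ (by simp)).1 h2⟩
    · rintro ⟨h1, h2⟩
      exact (hc ⟨z, hM.transitive _ hx h1⟩).2 ⟨h1, (h _ (by simp)).2 (by simpa using h2)⟩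
  exact this ▸ c.2

theorem IsSuitable.inter_mem (hM : IsSuitable κ M) {x y : ZFSet.{u}} (hx : x ∈ M) (hy : y ∈ M) :
    x ∩ y ∈ M := by
  rw [← ZFSet.sep_mem]
  exact hM.sep_mem_of_formula hx hy memFormula _ fun p hp => by rw [realize_memFormula, hp]

theorem IsSuitable.sdiff_mem (hM : IsSuitable κ M) {x y : ZFSet.{u}} (hx : x ∈ M) (hy : y ∈ M) :
    x \ y ∈ M := by
  rw [← ZFSet.sep_notMem]
  exact hM.sep_mem_of_formula hx hy memFormula.not _ fun p hp => by
    rw [Formula.realize_not, realize_memFormula, hp]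

end Suitable

/-! ### Filters generated by the trace of an ultrafilter -/

section GeneratedFilter

variable {κ : Cardinal.{u}}

theorem two_lt_lift (hreg : κ.IsRegular) : 2 < lift.{u + 1} κ := hreg.lift.nat_lt 2

/-- The `κ`-complete filter on `κ` generated by the elements of `V` in `N`. -/
noncomputable def genFilter (hreg : κ.IsRegular) (V : Set ZFSet.{u}) (N : ZFSet.{u}) :
    Filter (kset κ) :=
  Filter.cardinalGenerate {s | ∃ A ∈ V, A ∈ N ∧ s = {x | x.1 ∈ A}} (two_lt_lift hreg)

variable {hreg : κ.IsRegular}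

theorem mem_genFilter {V : Set ZFSet.{u}} {N : ZFSet.{u}} {s : Set (kset κ)} :
    s ∈ genFilter hreg V N ↔ ∃ S : Set ZFSet.{u}, S ⊆ V ∧ (∀ A ∈ S, A ∈ N) ∧
      #S < lift.{u + 1} κ ∧ {x : kset κ | ∀ A ∈ S, x.1 ∈ A} ⊆ s := by
  rw [genFilter, Filter.mem_cardinalGenerate_iff (hreg := hreg.lift)]
  constructor
  · rintro ⟨T, hT, hTc, hs⟩
    choose! A hAV hAN hA using hT
    refine ⟨A '' T, ?_, ?_, Cardinal.mk_image_le.trans_lt hTc, fun x hx => hs fun t ht => ?_⟩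
    · rintro _ ⟨t, ht, rfl⟩
      exact hAV ht
    · rintro _ ⟨t, ht, rfl⟩
      exact hAN ht
    · rw [hA ht]
      exact hx _ ⟨t, ht, rfl⟩
  · rintro ⟨S, hSV, hSN, hSc, hs⟩
    refine ⟨(fun A : ZFSet.{u} => {x : kset κ | x.1 ∈ A}) '' S, ?_,
      Cardinal.mk_image_le.trans_lt hSc, fun x hx => hs fun A hA => ?_⟩
    · rintro _ ⟨A, hA, rfl⟩
      exact ⟨A, hSV hA, hSN A hA, rfl⟩
    · exact hx _ ⟨A, hA, rfl⟩

theorem genFilter_le {V : Set ZFSet.{u}} {M N : ZFSet.{u}} (h : M ⊆ N) :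
    genFilter hreg V N ≤ genFilter hreg V M := by
  intro s hs
  obtain ⟨S, hSV, hSM, hSc, hs⟩ := mem_genFilter.1 hs
  exact mem_genFilter.2 ⟨S, hSV, fun A hA => h (hSM A hA), hSc, hs⟩

theorem genFilter_congr {V W : Set ZFSet.{u}} {N : ZFSet.{u}} (h : ∀ A ∈ N, A ∈ V ↔ A ∈ W) :
    genFilter hreg V N = genFilter hreg W N := by
  have : ({s | ∃ A ∈ V, A ∈ N ∧ s = {x | x.1 ∈ A}} : Set (Set (kset κ))) =
      {s | ∃ A ∈ W, A ∈ N ∧ s = {x | x.1 ∈ A}} := by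
    ext s
    exact exists_congr fun A => ⟨fun ⟨h1, h2⟩ => ⟨(h A h2.1).1 h1, h2⟩,
      fun ⟨h1, h2⟩ => ⟨(h A h2.1).2 h1, h2⟩⟩
  rw [genFilter, genFilter, this]

/-- The play in which Player I follows `τ` and Player II answers with the filters generated by the
traces of `V`. -/
noncomputable def tracePlay (hreg : κ.IsRegular) (τ : StrategyI κ) (V : Set ZFSet.{u})
    (i : Ordinal.{u}) : ZFSet.{u} × Filter (kset κ) :=
  (τ i fun j => tracePlay hreg τ V j.1,
    genFilter hreg V (τ i fun j => tracePlay hreg τ V j.1))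
termination_by i
decreasing_by all_goals exact j.2

theorem tracePlay_fst {τ : StrategyI κ} {V : Set ZFSet.{u}} {i : Ordinal.{u}} :
    (tracePlay hreg τ V i).1 = τ i fun j => tracePlay hreg τ V j.1 := by
  rw [tracePlay]

theorem tracePlay_snd {τ : StrategyI κ} {V : Set ZFSet.{u}} {i : Ordinal.{u}} :
    (tracePlay hreg τ V i).2 = genFilter hreg V (tracePlay hreg τ V i).1 := by
  rw [tracePlay]

/-- The filter answering a model `M_j` depends only on `V ∩ M_j`, so the `i`-th model depends only
on how `V` meets the earlier ones. This lets a fragment of `U` in the model replace `U` itself. -/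
theorem tracePlay_fst_congr {τ : StrategyI κ} {V W : Set ZFSet.{u}} {i : Ordinal.{u}}
    (h : ∀ j < i, ∀ A ∈ (tracePlay hreg τ V j).1, A ∈ V ↔ A ∈ W) :
    (tracePlay hreg τ V i).1 = (tracePlay hreg τ W i).1 := by
  induction i using WellFoundedLT.induction with
  | ind i ih =>
    rw [tracePlay_fst, tracePlay_fst]
    congr 1
    funext j
    have h1 := ih j.1 j.2 fun k hk => h k (hk.trans j.2)
    refine Prod.ext h1 ?_
    rw [tracePlay_snd, tracePlay_snd, ← h1]
    exact genFilter_congr (h j.1 j.2)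

end GeneratedFilter

/-! ### From stationarily many models to the game -/

section Backward

variable {κ : Cardinal.{u}}

/-- The sets `z ∈ κ` that belong to all values of the sequence `s`. -/
noncomputable def seqInter (κ : Cardinal.{u}) (s : ZFSet.{u}) : ZFSet.{u} :=
  ZFSet.sep (fun z => ∀ ξ y, ZFSet.pair ξ y ∈ s → z ∈ y) (kset κ)

/-- `f` is an injective function from `A` to `κ`. -/
def IsInjection (κ : Cardinal.{u}) (A f : ZFSet.{u}) : Prop :=
  ZFSet.IsFunc A (kset κ) f ∧
    ∀ x y z : ZFSet.{u}, ZFSet.pair x z ∈ f → ZFSet.pair y z ∈ f → x = y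

theorem exists_isInjection (hκ : ℵ₀ ≤ κ) (A : H (Order.succ κ)) :
    ∃ f : H (Order.succ κ), IsInjection κ A.1 f.1 := by
  have hA : #A.1 ≤ lift.{u + 1} κ := card_le_iff.1 (card_le_of_mem_H A.2)
  have hk : #(kset κ) = lift.{u + 1} κ := by
    rw [ZFSet.cardinalMk_coe_sort, kset, Ordinal.card_toZFSet, Cardinal.card_ord]
  obtain ⟨g⟩ : Nonempty (A.1 ↪ kset κ) := by
    rw [← Cardinal.le_def, hk]
    exact hA
  have hmem : ∀ {x y : ZFSet.{u}}, ZFSet.pair x y ∈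
      (ZFSet.range fun a : A.1 => ZFSet.pair a.1 (g a).1) ↔ ∃ hx : x ∈ A.1, (g ⟨x, hx⟩).1 = y := by
    intro x y
    rw [ZFSet.mem_range]
    constructor
    · rintro ⟨a, ha⟩
      obtain ⟨rfl, rfl⟩ := ZFSet.pair_inj.1 ha
      exact ⟨a.2, rfl⟩
    · rintro ⟨hx, rfl⟩
      exact ⟨⟨x, hx⟩, rfl⟩
  refine ⟨⟨ZFSet.range fun a : A.1 => ZFSet.pair a.1 (g a).1, range_mem_H hκ hA fun a =>
    pair_mem_H hκ (mem_H_of_mem A.2 a.2) (mem_H_of_mem kset_mem_H (g a).2)⟩, ⟨?_, ?_⟩, ?_⟩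
  · intro p hp
    obtain ⟨a, rfl⟩ := ZFSet.mem_range.1 hp
    exact ZFSet.pair_mem_prod.2 ⟨a.2, (g a).2⟩
  · intro x hx
    refine ⟨(g ⟨x, hx⟩).1, hmem.2 ⟨hx, rfl⟩, fun y hy => ?_⟩
    obtain ⟨_, h⟩ := hmem.1 hy
    exact h.symm
  · intro x y z hx hy
    obtain ⟨hx, rfl⟩ := hmem.1 hx
    obtain ⟨hy, h⟩ := hmem.1 hy
    exact (Subtype.mk.inj (g.injective (Subtype.ext h))).symm

/-- The four unary maps are packed into one function on finite sets, whose value at `{x}` is a pair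
of pairs; a transitive set closed under it contains the components. -/
theorem IsStationary.exists_closed {S : Set ZFSet.{u}} (hκ : ℵ₀ ≤ κ)
    (hS : IsStationary (H (Order.succ κ)) S) (htr : ∀ M ∈ S, M.IsTransitive)
    (g : Fin 4 → H (Order.succ κ) → H (Order.succ κ)) :
    ∃ M ∈ S, ∀ i (x : H (Order.succ κ)), x.1 ∈ M → (g i x).1 ∈ M := by
  obtain ⟨M, hM, hMH, hcl⟩ := hS fun s =>
    let x := Classical.epsilon fun x => s = {x}
    ⟨ZFSet.pair (ZFSet.pair (g 0 x).1 (g 1 x).1) (ZFSet.pair (g 2 x).1 (g 3 x).1),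
      pair_mem_H hκ (pair_mem_H hκ (g 0 x).2 (g 1 x).2) (pair_mem_H hκ (g 2 x).2 (g 3 x).2)⟩
  refine ⟨M, hM, fun i x hx => ?_⟩
  have h := hcl {x} (by simpa using hx)
  have hx : (Classical.epsilon fun y : H (Order.succ κ) => ({x} : Finset _) = {y}) = x :=
    (Finset.singleton_injective (Classical.epsilon_spec
      (p := fun y : H (Order.succ κ) => ({x} : Finset _) = {y}) ⟨x, rfl⟩)).symm
  simp only [hx] at h
  obtain ⟨h1, h2⟩ := mem_of_pair_mem (htr M hM) h
  obtain ⟨h3, h4⟩ := mem_of_pair_mem (htr M hM) h1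
  obtain ⟨h5, h6⟩ := mem_of_pair_mem (htr M hM) h2
  fin_cases i <;> assumption

/-- The family of the elements of a `κ`-complete `M`-ultrafilter is closed under intersections of
fewer than `κ` elements, if `M` is closed under the intersection of sequences. -/
theorem inter_mem_of_isComplete {M : ZFSet.{u}} {U : Set ZFSet.{u}} (hκ : ℵ₀ ≤ κ)
    (hM : IsSuitable κ M) (hU : IsMUltrafilter M (kset κ) U) (hc : IsComplete κ (kset κ) U)
    (hcl : ∀ s ∈ M, seqInter κ s ∈ M) {S : Set ZFSet.{u}} (hS : S ⊆ U)
    (hSc : #S < lift.{u + 1} κ) : ZFSet.sep (fun z => ∀ A ∈ S, z ∈ A) (kset κ) ∈ U := by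
  classical
  obtain ⟨c, hcS⟩ := Cardinal.mem_range_lift_of_le hSc.le
  have hcκ : c < κ := by rwa [← hcS, Cardinal.lift_lt] at hSc
  -- Enumerating `S` in a length below `κ` makes the enumeration an element of `M`, so the
  -- intersection is in `M` as well.
  obtain ⟨e⟩ : Nonempty (Set.Iio c.ord ≃ S) := by
    rw [← Cardinal.eq, Cardinal.mk_Iio_ordinal, Cardinal.card_ord, hcS]
  let g : Ordinal.{u} → ZFSet.{u} := fun ξ => if h : ξ < c.ord then (e ⟨ξ, h⟩).1 else ∅
  have hg : ∀ ξ (h : ξ < c.ord), g ξ = (e ⟨ξ, h⟩).1 := fun ξ h => dif_pos h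
  have heq : seqInter κ (seqSet c.ord g) = ZFSet.sep (fun z => ∀ A ∈ S, z ∈ A) (kset κ) := by
    ext z
    simp only [seqInter, mem_sep']
    refine and_congr_right fun _ => ⟨fun h A hA => ?_, fun h ξ y hy => ?_⟩
    · have hlt := (e.symm ⟨A, hA⟩).2
      refine h (e.symm ⟨A, hA⟩).1.toZFSet A (mem_seqSet.2 ⟨_, hlt, ?_⟩)
      rw [hg _ hlt]
      simp
    · obtain ⟨η, hη, hp⟩ := mem_seqSet.1 hy
      obtain ⟨-, rfl⟩ := ZFSet.pair_inj.1 hp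
      rw [hg _ hη]
      exact h _ (e ⟨η, hη⟩).2
  have hmem : ZFSet.sep (fun z => ∀ A ∈ S, z ∈ A) (kset κ) ∈ M := by
    rw [← heq]
    refine hcl _ (hM.closed _ (Cardinal.ord_lt_ord.2 hcκ) _ fun ξ hξ => ?_)
    rw [hg _ hξ]
    exact (hU.mem_algebra _ (hS (e ⟨ξ, hξ⟩).2)).1
  -- If the complement were in `U`, adding it to `S` would still give fewer than `κ` sets of `U`,
  -- but with no common point.
  refine (hU.mem_or_compl_mem _ hmem ZFSet.sep_subset).resolve_right fun hcompl => ?_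
  obtain ⟨x, hx, hxS⟩ := hc (insert (kset κ \ ZFSet.sep (fun z => ∀ A ∈ S, z ∈ A) (kset κ)) S)
    (Set.insert_subset hcompl hS)
    (Cardinal.mk_insert_le.trans_lt (Cardinal.add_lt_of_lt (by simpa using hκ) hSc
      (Cardinal.one_lt_aleph0.trans_le (by simpa using hκ))))
  have h1 := hxS _ (Set.mem_insert _ _)
  rw [ZFSet.mem_sdiff, mem_sep'] at h1
  exact h1.2 ⟨hx, fun A hA => hxS A (Set.mem_insert_of_mem _ hA)⟩

/-! ### Filters generated by `U ∩ M` are legal answers -/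

section Constraint

variable {hreg : κ.IsRegular} {T M : ZFSet.{u}} {U : Set ZFSet.{u}}

/-- Each member of the generated filter includes an intersection that lies in `U`, so a member that
belongs to `M ⊆ T` is in `U` by upward closure: generating adds nothing inside `M`. -/
theorem trace_genFilter (hU : IsMUltrafilter T (kset κ) U)
    (hinter : ∀ S ⊆ U, #S < lift.{u + 1} κ →
      ZFSet.sep (fun z => ∀ A ∈ S, z ∈ A) (kset κ) ∈ U) (hMT : M ⊆ T) :
    trace κ (genFilter hreg U M) M = {A | A ∈ M ∧ A ∈ U} := by
  ext A
  constructor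
  · rintro ⟨hA, hAX, hAF⟩
    obtain ⟨S, hSU, -, hSc, hs⟩ := mem_genFilter.1 hAF
    refine ⟨hA, hU.mem_of_superset _ (hinter S hSU hSc) _ (hMT hA) hAX fun z hz => ?_⟩
    obtain ⟨hz, h⟩ := mem_sep'.1 hz
    exact hs (a := ⟨z, hz⟩) h
  · rintro ⟨hA, hAU⟩
    refine ⟨hA, (hU.mem_algebra A hAU).2, mem_genFilter.2 ⟨{A}, by simpa using hAU,
      by simpa using hA, ?_, ?_⟩⟩
    · rw [Cardinal.mk_singleton]
      exact hreg.lift.nat_lt 1 |>.trans_eq' (by simp)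
    · intro x hx
      exact hx A rfl

theorem genFilter_mem_filterConstraint (hU : IsMUltrafilter T (kset κ) U)
    (hc : IsComplete κ (kset κ) U) (hunif : IsUniform κ U)
    (hinter : ∀ S ⊆ U, #S < lift.{u + 1} κ →
      ZFSet.sep (fun z => ∀ A ∈ S, z ∈ A) (kset κ) ∈ U) (hMT : M ⊆ T) (hM : IsSuitable κ M) :
    genFilter hreg U M ∈ filterConstraint κ M := by
  have htr := trace_genFilter (hreg := hreg) hU hinter hMT
  refine ⟨Filter.cardinalInter_ofCardinalGenerate _ _, ?_, ?_, ?_⟩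
  · intro s hs
    obtain ⟨S, hSU, -, hSc, hs⟩ := mem_genFilter.1 hs
    have hB := hunif _ (hinter S hSU hSc)
    apply le_antisymm
    · refine (Cardinal.mk_set_le s).trans_eq ?_
      rw [ZFSet.cardinalMk_coe_sort, kset, Ordinal.card_toZFSet, Cardinal.card_ord]
    · refine (congrArg (lift.{u + 1}) hB).ge.trans ?_
      rw [← ZFSet.cardinalMk_coe_sort]
      refine Cardinal.mk_le_of_injective (f := fun x =>
        ⟨⟨x.1, (mem_sep'.1 x.2).1⟩, hs (mem_sep'.1 x.2).2⟩) fun x y h => Subtype.ext ?_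
      simpa using h
  · rw [htr]
    refine ⟨fun A hA => ⟨hA.1, (hU.mem_algebra A hA.2).2⟩, ⟨hM.card_mem, hU.whole_mem⟩,
      fun h => hU.empty_notMem h.2,
      fun A hA B hB => ⟨hM.inter_mem hA.1 hB.1, hU.inter_mem A hA.2 B hB.2⟩,
      fun A hA B hB hBX hAB => ⟨hB, hU.mem_of_superset A hA.2 B (hMT hB) hBX hAB⟩,
      fun A hA hAX => (hU.mem_or_compl_mem A (hMT hA) hAX).imp (fun h => ⟨hA, h⟩)
        fun h => ⟨hM.sdiff_mem hM.card_mem hA, h⟩⟩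
  · rw [htr]
    exact fun S hS hSc => hc S (fun A hA => (hS hA).2) hSc

end Constraint

theorem not_winning_of_isStationary (hreg : κ.IsRegular)
    (hstat : IsStationary (H (Order.succ κ))
      {M | IsSuitable κ M ∧ IsInternallyApproachable κ M ∧
        ∃ U : Set ZFSet.{u}, IsMUltrafilter M (kset κ) U ∧ IsComplete κ (kset κ) U ∧
          IsUniform κ U ∧ IsAmenable κ M (kset κ) U}) :
    ¬ PlayerIHasWinningStrategy κ (filterConstraint κ) (Order.succ κ).ord := by
  rintro ⟨τ, hlegal, hwin⟩
  have hκ := hreg.aleph0_le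
  have hreg' : (Order.succ κ).IsRegular := Cardinal.isRegular_succ hκ
  -- `x` codes a pair `(W, i)` and `y` is the `i`-th model of the play computed from `W`. It is a
  -- relation, not a function, because for arbitrary `W` that set need not be in `H(κ⁺)`.
  let IsNext : H (Order.succ κ) → H (Order.succ κ) → Prop := fun x y =>
    ∃ (W : ZFSet.{u}) (i : Ordinal.{u}), x.1 = ZFSet.pair W i.toZFSet ∧
      y.1 = (tracePlay hreg τ W i).1
  obtain ⟨T, ⟨hT, ⟨N, hNs, hNT, hNseq⟩, U, hU, hc, hunif, ham⟩, hcl⟩ := hstat.exists_closed hκ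
    (fun M hM => hM.1.transitive)
    -- The first two maps supply the hypotheses of amenability for `P(κ) ∩ N β`, the third computes
    -- moves of `τ`, and the fourth gives closure of `U` under short intersections.
    ![fun x => ⟨ZFSet.sep (· ⊆ kset κ) x.1, mem_H_of_subset x.2 ZFSet.sep_subset⟩,
      fun x => Classical.epsilon fun f => IsInjection κ x.1 f.1,
      fun x => Classical.epsilon (IsNext x),
      fun x => ⟨seqInter κ x.1, mem_H_of_subset kset_mem_H ZFSet.sep_subset⟩]
  have hclP : ∀ x ∈ T, ZFSet.sep (· ⊆ kset κ) x ∈ T := fun x hx => hcl 0 ⟨x, hT.subset_H hx⟩ hx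
  have hclI : ∀ x ∈ T, CardLEIn κ T x := fun x hx =>
    ⟨_, hcl 1 ⟨x, hT.subset_H hx⟩ hx, Classical.epsilon_spec
      (p := fun f : H (Order.succ κ) => IsInjection κ x f.1)
      (exists_isInjection hκ ⟨x, hT.subset_H hx⟩)⟩
  have hclN : ∀ (W : ZFSet.{u}) (i : Ordinal.{u}), ZFSet.pair W i.toZFSet ∈ T →
      (tracePlay hreg τ W i).1 ∈ H (Order.succ κ) → (tracePlay hreg τ W i).1 ∈ T := by
    intro W i hx hH
    have h1 := hcl 2 ⟨_, hT.subset_H hx⟩ hx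
    obtain ⟨W', i', hp, he⟩ := Classical.epsilon_spec (p := IsNext ⟨_, hT.subset_H hx⟩)
      ⟨⟨_, hH⟩, W, i, rfl, rfl⟩
    obtain ⟨rfl, hi⟩ := ZFSet.pair_inj.1 hp
    obtain rfl := Ordinal.toZFSet_injective hi
    exact he ▸ h1
  have hclS : ∀ s ∈ T, seqInter κ s ∈ T := fun x hx => hcl 3 ⟨x, hT.subset_H hx⟩ hx
  have hinter : ∀ S ⊆ U, #S < lift.{u + 1} κ →
      ZFSet.sep (fun z => ∀ A ∈ S, z ∈ A) (kset κ) ∈ U := fun S hS hSc =>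
    inter_mem_of_isComplete hκ hT hU hc hclS hS hSc
  have hNlt : ∀ {α β}, α < β → β < (Order.succ κ).ord → α.toZFSet ∈ N β ∧ N α ∈ N β := by
    intro α β hαβ hβ
    exact mem_of_pair_mem (hNs β hβ).transitive
      ((hNs β hβ).transitive _ (hNseq β hβ) (mem_seqSet.2 ⟨α, hαβ, rfl⟩))
  have hNle : ∀ {α β}, α ≤ β → β < (Order.succ κ).ord → N α ⊆ N β := by
    intro α β hαβ hβ
    rcases hαβ.eq_or_lt with rfl | hαβ
    · exact fun _ h => h
    · exact (hNs β hβ).transitive _ (hNlt hαβ hβ).2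
  have hNmem : ∀ β < (Order.succ κ).ord, β.toZFSet ∈ T ∧ N β ∈ T := by
    intro β hβ
    have hβ' := succ_lt_ord hreg'.aleph0_le hβ
    obtain ⟨h1, h2⟩ := hNlt (lt_add_one β) hβ'
    exact ⟨(hNT _).2 ⟨_, hβ', h1⟩, (hNT _).2 ⟨_, hβ', h2⟩⟩
  let M : Ordinal.{u} → ZFSet.{u} := fun i => (tracePlay hreg τ U i).1
  let F : Ordinal.{u} → Filter (kset κ) := fun i => (tracePlay hreg τ U i).2
  have hF : ∀ i, F i = genFilter hreg U (M i) := fun i => tracePlay_snd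
  have hfol : ∀ i, τ.Follows M F i := fun i => tracePlay_fst
  -- The two claims are proved together: the move of `τ` at stage `i` is known to be legal only once
  -- the earlier answers are.
  have key : ∀ i < (Order.succ κ).ord, M i ∈ T ∧ LegalII κ (filterConstraint κ) M F i := by
    intro i
    induction i using WellFoundedLT.induction with
    | ind i ih =>
      intro hi
      obtain ⟨hsuit, hcard, hsub⟩ := hlegal M F i hi
        (fun j hj => ⟨hfol j, (ih j hj (hj.trans hi)).2⟩) (hfol i)
      have hMH : M i ∈ H (Order.succ κ) := by
        refine mem_H_of_isTransitive hsuit.transitive (hcard.trans ?_)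
        exact (mul_le_mul_right (max_le (Cardinal.one_le_aleph0.trans hκ)
          (card_le_of_lt_succ_ord hi)) κ).trans (Cardinal.mul_eq_self hκ).le
      have hMT : M i ∈ T := by
        choose g hg hgM using fun j : Set.Iio i =>
          (hNT (M j.1)).1 (ih j.1 j.2 (j.2.trans hi)).1
        obtain ⟨β, hβ, hle⟩ := exists_lt_ord_forall_le hreg' (mk_Iio_lt_lift hi) g hg
        -- All earlier models are elements, hence subsets, of `N β`, so `W` agrees with `U` on each
        -- of them.
        let W : ZFSet.{u} := ZFSet.sep (· ∈ U) (ZFSet.sep (· ⊆ kset κ) (N β))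
        have hP := hclP _ (hNmem β hβ).2
        have hW : W ∈ T := ham _ hP (fun A hA => by
          obtain ⟨h1, h2⟩ := mem_sep'.1 hA
          exact ⟨(hNT A).2 ⟨β, hβ, h1⟩, h2⟩) (hclI _ hP)
        have heq : M i = (tracePlay hreg τ W i).1 := by
          refine tracePlay_fst_congr fun j hj A hA => ?_
          have hAN : A ∈ N β :=
            (hNs β hβ).transitive _ (hNle (hle ⟨j, hj⟩) hβ (hgM ⟨j, hj⟩)) hA
          refine ⟨fun h => mem_sep'.2 ⟨mem_sep'.2 ⟨hAN, (hU.mem_algebra A h).2⟩, h⟩,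
            fun h => (mem_sep'.1 h).2⟩
        rw [heq] at hMH ⊢
        exact hclN W i (hT.pair_mem hW (hNmem i hi).1) hMH
      refine ⟨hMT, ?_, fun j hj => ?_⟩
      · rw [hF]
        exact genFilter_mem_filterConstraint hU hc hunif hinter (hT.transitive _ hMT) hsuit
      · rw [hF, hF]
        exact genFilter_le (hsub j hj)
  exact hwin ⟨M, F, fun i hi => ⟨hfol i, (key i hi).2⟩⟩

end Backward

end FilterGame

theorem mainTheorem9 (κ : Cardinal.{u}) (hreg : κ.IsRegular) (hpow : κ ^< κ = κ) :
    ¬ FilterGame.PlayerIHasWinningStrategy κ (FilterGame.filterConstraint κ)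
        (Order.succ κ).ord ↔
      FilterGame.IsStationary (FilterGame.H (Order.succ κ))
        {M | FilterGame.IsSuitable κ M ∧ FilterGame.IsInternallyApproachable κ M ∧
          ∃ U : Set ZFSet.{u}, FilterGame.IsMUltrafilter M (FilterGame.kset κ) U ∧
            FilterGame.IsComplete κ (FilterGame.kset κ) U ∧
            FilterGame.IsUniform κ U ∧
            FilterGame.IsAmenable κ M (FilterGame.kset κ) U} :=
  ⟨FilterGame.isStationary_of_not_winning hreg hpow, FilterGame.not_winning_of_isStationary hreg⟩
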